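/- Let $n\ge 1$ be an integer, $\sigma_x^2,\sigma_w^2>0$, $\Omega=\sigma_x^2/\sigma_w^2$, and let $x\in\mathbb R^n$ with $\|x\|^2=n\sigma_x^2$. Consider the test between $H_1:\ y\sim \mathcal N(x,\sigma_w^2I_n)$ (density $p_{y|x}$) and $H_0:\ y\sim \mathcal N(0,(\sigma_x^2+\sigma_w^2)I_n)$ (density $q_y$) which selects $H_1$ if and only if $\Lambda(x,y)=\frac1n\ln\frac{p_{y|x}(y|x)}{q_y(y)}\ge\lambda$, and let $$P_{\rm MD}=\Pr[\Lambda(x,y)<\lambda\mid H_1],\qquad P_{\rm FA}=\Pr[\Lambda(x,y)\ge\lambda\mid H_0]$$ be its missed detection (MD) and false alarm (FA) probabilities. Let the threshold be parametrized by $\gamma$ through $2\lambda=1+\ln(1+\Omega)-\frac{\Omega}{1+\Omega}\lambda'$, $\lambda'=\Omega/(4s_\gamma^2)$, where $s_\gamma=\sinh\gamma$, $c_\gamma=\cosh\gamma$, and assume $$\tfrac12\ln\Big(1+\tfrac{\Omega}{1+\Omega}\Big)<\gamma<\tfrac12\ln(1+\Omega).$$ For each of the two cases put $\theta_{\rm MD}=\ln(\Omega/(2s_\gamma))$,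 $\theta_{\rm FA}=\theta_{\rm MD}-\ln(1+\Omega)$, and, with $\theta$ the value for the case considered, $s={\rm sign}(\gamma-\theta)$, $\alpha(z)=c_\gamma-\cosh z+s_\gamma(z-\gamma)$, $v=-\alpha(\theta)/s_\gamma$. Let $t(u)$, $u\in\mathbb R$, be the inverse of $t^{-1}(z)={\rm sign}(\Im z)\sqrt{2\alpha(\ln z)}$ (principal branches), with $t(0)=e^\gamma$, let $f(u)=t'(u)/(e^\theta-t(u))$, and let $c_k$ be the coefficients of its Taylor expansion $f(u)=i\sum_{k\ge0}c_ku^k$ at $u=0$ (the $c_{2k}$ are real). For $K\ge1$ let $$g^{(K)}=\frac1{2\sqrt\pi}\sum_{k=0}^{K-1}c_{2k}\frac{\Gamma(k+\frac12)}{\Gamma(\frac12)}\Big(\frac{4s_\gamma}{n}\Big)^{k+\frac12},$$ $$P_{\rm MD}^{(K)}=1(s_{\rm MD})+g_{\rm MD}^{(K)}e^{-\frac12nv_{\rm MD}},\qquad P_{\rm FA}^{(K)}=1(-s_{\rm FA})-g_{\rm FA}^{(K)}e^{-\frac12nv_{\rm FA}},$$ where $1(z)=1$ for $z\ge0$ and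 $1(z)=0$ for $z<0$. For $\phi\in(0,\pi)$ let ${\rm sinc}(\phi)=\sin(\phi)/\phi$ and $$r(\phi)={\rm asinh}(s_\gamma/{\rm sinc}(\phi)),\qquad r'(\phi)=\frac{1/\phi-\cot\phi}{\sqrt{1+{\rm sinc}^2(\phi)/s_\gamma^2}},$$ $$h(\phi)=(1-\cos\phi)\cosh r(\phi)+\alpha(r(\phi)),\qquad u(\phi)=\sqrt{2h(\phi)},\qquad h'(\phi)=\sin(\phi)\cosh(r(\phi))\,[1+r'(\phi)^2],$$ $$\tilde g(\phi)=\frac{e^{\theta-r(\phi)}[\cos\phi+r'(\phi)\sin\phi]-1}{e^{2(\theta-r(\phi))}-2\cos(\phi)e^{\theta-r(\phi)}+1},\qquad c(\phi)=\frac{\tilde g(\phi)u(\phi)}{h'(\phi)}.$$ **Theorem.** Let $L,U\ge1$ be integers. In each of the cases MD and FA (with $P$ and $P^{(K)}$ denoting the corresponding probability and approximation): * if $\;1+\sum_{k=1}^{L-1}\frac{c_{2k}}{c_0}u^{2k}(\phi)\le\frac{c(\phi)}{c_0}\;$ for all $\phi\in(0,\pi)$, then $P^{(L)}\le P$; * if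 $\;\frac{c(\phi)}{c_0}\le1+\sum_{k=1}^{U-1}\frac{c_{2k}}{c_0}u^{2k}(\phi)\;$ for all $\phi\in(0,\pi)$, then $P\le P^{(U)}$. In particular, if both conditions hold in both cases, then $P_{\rm MD}^{(L)}\le P_{\rm MD}\le P_{\rm MD}^{(U)}$ and $P_{\rm FA}^{(L)}\le P_{\rm FA}\le P_{\rm FA}^{(U)}$. (At $\phi=0$, where $c(\phi)/c_0$ is understood as its limit $1$ and $u=0$, both conditions hold trivially with equality, so that it is the same to ask for them on $[0,\pi)$.) -/

import Mathlib

noncomputable section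

namespace AWGN

/-- Codewords of constant energy: the vectors of `ℝⁿ` with `‖x‖² = n σₓ²`, where `vx = σₓ²`. -/
def codewords (n : ℕ) (vx : NNReal) : Set (EuclideanSpace ℝ (Fin n)) :=
  {x | ‖x‖ ^ 2 = n * (vx : ℝ)}

/-- The signal to noise ratio `Ω = σₓ² / σ_w²`. -/
def snr (vx vw : NNReal) : ℝ := (vx : ℝ) / (vw : ℝ)

/-- Law of the received vector under `H₁`: the memoryless Gaussian channel with input `x` and
noise variance `vw = σ_w²`. -/
def lawH1 {n : ℕ} (vw : NNReal) (x : EuclideanSpace ℝ (Fin n)) :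
    MeasureTheory.Measure (Fin n → ℝ) :=
  MeasureTheory.Measure.pi fun i => ProbabilityTheory.gaussianReal (x i) vw

/-- Law of the received vector under `H₀`: `N(0, σ_y² Iₙ)` with `σ_y² = σₓ² + σ_w²`. -/
def lawH0 (n : ℕ) (vx vw : NNReal) : MeasureTheory.Measure (Fin n → ℝ) :=
  MeasureTheory.Measure.pi fun _ => ProbabilityTheory.gaussianReal 0 (vx + vw)

/-- The channel transition density `p_{y|x}(y|x)`. -/
def densH1 {n : ℕ} (vw : NNReal) (x : EuclideanSpace ℝ (Fin n)) (y : Fin n → ℝ) : ℝ :=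
  ∏ i, ProbabilityTheory.gaussianPDFReal (x i) vw (y i)

/-- The auxiliary output density `q_y(y)`. -/
def densH0 {n : ℕ} (vx vw : NNReal) (y : Fin n → ℝ) : ℝ :=
  ∏ i, ProbabilityTheory.gaussianPDFReal 0 (vx + vw) (y i)

/-- The normalized log-likelihood ratio `Λ(x,y) = (1/n) ln (p_{y|x}(y|x) / q_y(y))`. -/
def llr {n : ℕ} (vx vw : NNReal) (x : EuclideanSpace ℝ (Fin n)) (y : Fin n → ℝ) : ℝ :=
  1 / (n : ℝ) * Real.log (densH1 vw x y / densH0 vx vw y)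

/-- The two types of error of the test: missed detection and false alarm. -/
inductive ErrorType
  | MD
  | FA

/-- The error probabilities of the threshold test that selects `H₁` iff `Λ(x,y) ≥ lam`:
`P_MD = P[Λ < lam | H₁, x]` and `P_FA = P[Λ ≥ lam | H₀, x]`. -/
def errorProb {n : ℕ} (vx vw : NNReal) (x : EuclideanSpace ℝ (Fin n)) (lam : ℝ) :
    ErrorType → ℝ
  | .MD => (lawH1 vw x).real {y | llr vx vw x y < lam}
  | .FA => (lawH0 n vx vw).real {y | lam ≤ llr vx vw x y}

/-- The threshold `lam` attached to `γ > 0`: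
`2 lam = 1 + ln(1+Ω) - Ω/(1+Ω) lam'` with `lam' = Ω / (4 sinh² γ)`. -/
def threshold (Ω γ : ℝ) : ℝ :=
  (1 + Real.log (1 + Ω) - Ω / (1 + Ω) * (Ω / (4 * Real.sinh γ ^ 2))) / 2

/-- `θ(γ) = ln(Ω/(2 sinh γ))` for MD, and the same minus `ln(1+Ω)` for FA. -/
def theta (Ω γ : ℝ) : ErrorType → ℝ
  | .MD => Real.log (Ω / (2 * Real.sinh γ))
  | .FA => Real.log (Ω / (2 * Real.sinh γ)) - Real.log (1 + Ω)

/-- `α(x) = cosh γ - cosh x + (x - γ) sinh γ`, at real arguments. -/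
def alpha (γ x : ℝ) : ℝ :=
  Real.cosh γ - Real.cosh x + Real.sinh γ * (x - γ)

/-- The function `α` at complex arguments. -/
def alphaC (γ : ℝ) (x : ℂ) : ℂ :=
  (Real.cosh γ : ℂ) - Complex.cosh x + (Real.sinh γ : ℂ) * (x - (γ : ℂ))

/-- `s(γ) = sign(γ - θ(γ))`. -/
def sgn (Ω γ : ℝ) (b : ErrorType) : ℝ := Real.sign (γ - theta Ω γ b)

/-- `v(γ) = -α(θ(γ)) / sinh γ`. -/
def vExp (Ω γ : ℝ) (b : ErrorType) : ℝ := -alpha γ (theta Ω γ b) / Real.sinh γ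

/-- The unit step function, equal to `1` for `x ≥ 0` and to `0` otherwise. -/
def unitStep (x : ℝ) : ℝ := if 0 ≤ x then 1 else 0

/-- The function `t⁻¹(x) = sign(Im x) √(2 α(ln x))` (principal branches). -/
def tInv (γ : ℝ) (x : ℂ) : ℂ :=
  (Real.sign x.im : ℂ) * (2 * alphaC γ (Complex.log x)) ^ (1 / 2 : ℂ)

/-- The function `t(u)` of a real variable, inverse to `tInv`. For `γ > 0` and each real `u ≠ 0`
there is exactly one `x` with `tInv γ x = u`: with `x = exp (r + i φ)`, `0 < |φ| < π`, reality of
`α(r + i φ)` forces `sinh r = φ sinh γ / sin φ`, and `α` increases from `0` to `∞` in `|φ|` along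
this curve. The value `t(0) = e^γ` is the limit as `u → 0`. -/
def tFun (γ : ℝ) (u : ℝ) : ℂ :=
  if u = 0 then (Real.exp γ : ℂ) else Function.invFun (tInv γ) (u : ℂ)

/-- `f(u) = t'(u) / (e^θ - t(u))`. -/
def fFun (Ω γ : ℝ) (b : ErrorType) (u : ℝ) : ℂ :=
  deriv (tFun γ) u / ((Real.exp (theta Ω γ b) : ℂ) - tFun γ u)

/-- The coefficients `c_j` of the Taylor expansion `f(u) = i ∑ c_j u^j` at `u = 0`. -/
def taylorCoeff (Ω γ : ℝ) (b : ErrorType) (j : ℕ) : ℂ :=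
  iteratedDeriv j (fFun Ω γ b) 0 / (Nat.factorial j : ℂ) / Complex.I

/-- The coefficients `c_{2k}`, which are real valued. -/
def cEven (Ω γ : ℝ) (b : ErrorType) (k : ℕ) : ℝ := (taylorCoeff Ω γ b (2 * k)).re

/-- The asymptotic series of `g(γ)` limited to its first `K` terms `k = 0, …, K-1`. -/
def gTrunc (n : ℕ) (Ω γ : ℝ) (b : ErrorType) (K : ℕ) : ℝ :=
  1 / (2 * Real.sqrt Real.pi) * ∑ k ∈ Finset.range K,
    cEven Ω γ b k * (Real.Gamma ((k : ℝ) + 1 / 2) / Real.Gamma (1 / 2)) *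
      (4 * Real.sinh γ / (n : ℝ)) ^ ((k : ℝ) + 1 / 2)

/-- The `K`-term approximations `P_MD^(K)` and `P_FA^(K)`. -/
def errorApprox (n : ℕ) (Ω γ : ℝ) (K : ℕ) : ErrorType → ℝ
  | .MD => unitStep (sgn Ω γ .MD) +
      gTrunc n Ω γ .MD K * Real.exp (-(1 / 2) * n * vExp Ω γ .MD)
  | .FA => unitStep (-sgn Ω γ .FA) -
      gTrunc n Ω γ .FA K * Real.exp (-(1 / 2) * n * vExp Ω γ .FA)

/-- `r(φ) = asinh(sinh γ / sinc φ)`. -/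
def rPhi (γ φ : ℝ) : ℝ := Real.arsinh (Real.sinh γ / Real.sinc φ)

/-- The function `r'(φ)`. -/
def rPhi' (γ φ : ℝ) : ℝ :=
  (1 / φ - Real.cot φ) / Real.sqrt (1 + Real.sinc φ ^ 2 / Real.sinh γ ^ 2)

/-- The function `g̃(φ)`. -/
def gTilde (Ω γ : ℝ) (b : ErrorType) (φ : ℝ) : ℝ :=
  (Real.exp (theta Ω γ b - rPhi γ φ) * (Real.cos φ + rPhi' γ φ * Real.sin φ) - 1) /
    (Real.exp (2 * (theta Ω γ b - rPhi γ φ)) -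
      2 * Real.cos φ * Real.exp (theta Ω γ b - rPhi γ φ) + 1)

/-- `h(φ) = (1 - cos φ) cosh r(φ) + α(r(φ))`. -/
def hPhi (γ φ : ℝ) : ℝ :=
  (1 - Real.cos φ) * Real.cosh (rPhi γ φ) + alpha γ (rPhi γ φ)

/-- `h'(φ) = sin φ cosh r(φ) (1 + r'(φ)²)`. -/
def hPhi' (γ φ : ℝ) : ℝ :=
  Real.sin φ * Real.cosh (rPhi γ φ) * (1 + rPhi' γ φ ^ 2)

/-- `u(φ) = √(2 h(φ))`. -/
def uPhi (γ φ : ℝ) : ℝ := Real.sqrt (2 * hPhi γ φ)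

/-- `c(φ) = g̃(φ) u(φ) / h'(φ)`, for `0 < φ < π`. At `φ = 0` the formula reads `0/0`. -/
def cPhi (Ω γ : ℝ) (b : ErrorType) (φ : ℝ) : ℝ :=
  gTilde Ω γ b φ * uPhi γ φ / hPhi' γ φ

/-- `1 + ∑_{k=1}^{K-1} (c_{2k}/c_0) u(φ)^{2k}`. -/
def ratioTrunc (Ω γ : ℝ) (b : ErrorType) (K : ℕ) (φ : ℝ) : ℝ :=
  1 + ∑ k ∈ Finset.Ico 1 K, cEven Ω γ b k / cEven Ω γ b 0 * uPhi γ φ ^ (2 * k)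

end AWGN

end

namespace AWGN

open Filter Topology Set MeasureTheory

/-! ### The path of steepest descent -/

/-! Completing the square shows that `Λ ≥ λ` means that a normalized squared distance `Q` of `y`
from a multiple of `x` is at most a threshold `q`. Under either hypothesis `Q` is noncentral
chi-square with noncentrality `n/Ω'`, where `Ω'` is `Ω` for MD and `Ω/(1+Ω)` for FA. So MD asks for
`P(Q > q)` and FA for `P(Q ≤ q)`.

Invert the Laplace transform of `Q` on a vertical line and substitute `x = e^θ(1+2τ)`. The integrand
becomes `exp(-a α(ln x)) / (e^θ - x)`, with `a = n/(2 s_γ)` and saddle point `e^γ`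
(`expectation_step_eq`). The hypotheses on `γ` say `θ_FA < γ < θ_MD`, so the line through the saddle
is on the right side of the pole in both cases and no residue appears.

Now deform the line into the curve where `α` is real, `sinh r · sin φ = s_γ φ`
(`integral_kernel_line_eq`). On it `α = h(φ)` increases from `0` to `∞`, and `P = ± e^{aα(θ)}/π ·
∫₀^π e^{-ah} g̃ dφ` (`errorProb_eq`).

Since `g̃ dφ = c(φ) du`, replacing `c(φ)` by `∑ c_{2k} u^{2k}` produces Gaussian moments, which add
up to exactly `g^{(K)}` (`gTrunc_eq_integral`). Pointwise inequalities therefore integrate to the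
bounds. Convergence of the Taylor series plays no role: the higher `c_{2k}` enter merely as real
numbers, and only `c_0` is computed, for its sign (`cEven_zero`). For FA `c_0 < 0` reverses the
pointwise inequality, and the minus sign in front of the integral reverses it back. -/

lemma sinc_pos {φ : ℝ} (hφ : φ ∈ Ioo (-Real.pi) Real.pi) : 0 < Real.sinc φ := by
  wlog h : 0 ≤ φ generalizing φ
  · rw [← Real.sinc_neg]
    exact this ⟨by linarith [hφ.2], by linarith [hφ.1]⟩ (by linarith)
  rcases h.eq_or_lt with rfl | h
  · simp
  · rw [Real.sinc_of_ne_zero h.ne']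
    exact div_pos (Real.sin_pos_of_pos_of_lt_pi h hφ.2) h

lemma sinc_mul_self (φ : ℝ) : Real.sinc φ * φ = Real.sin φ := by
  rcases eq_or_ne φ 0 with rfl | h
  · simp
  · rw [Real.sinc_of_ne_zero h, div_mul_cancel₀ _ h]

lemma hasDerivAt_sinc_zero : HasDerivAt Real.sinc 0 0 := by
  rw [hasDerivAt_iff_tendsto_slope]
  -- As `x - x³/6 < sin x ≤ x` for `x > 0`, the slope is `O(|x|)`; the constants are deliberately
  -- loose.
  have hb : ∀ x : ℝ, x ∈ ({0}ᶜ : Set ℝ) → ‖slope Real.sinc 0 x‖ ≤ |x| / 4 * (1 + |x|) := by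
    intro x hx
    have hx0 : x ≠ 0 := hx
    wlog hpos : 0 < x generalizing x
    · have hn : 0 < -x := by
        rcases lt_or_gt_of_ne hx0 with h | h
        · linarith
        · exact absurd h hpos
      have := this (-x) (by simpa using hx0) (by simpa using hx0) hn
      have e : slope Real.sinc 0 (-x) = - slope Real.sinc 0 x := by
        simp [slope_def_field, div_neg]
      rw [e, norm_neg, abs_neg] at this
      exact this
    rw [slope_def_field, Real.sinc_zero, sub_zero, Real.sinc_of_ne_zero hx0, Real.norm_eq_abs,
      abs_div, abs_of_pos hpos, div_le_iff₀ hpos]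
    have h2 := Real.sin_gt_sub_cube hpos
    have h3 := Real.sin_le hpos.le
    have h4 : 1 - x ^ 2 / 6 ≤ Real.sin x / x := by
      rw [le_div_iff₀ hpos]; nlinarith
    have h5 : Real.sin x / x ≤ 1 := by rwa [div_le_one hpos]
    have h6 : 0 ≤ x / 4 * (1 + x) * x := by positivity
    rw [abs_le]
    constructor <;> nlinarith [pow_pos hpos 2, pow_pos hpos 3]
  refine squeeze_zero_norm' (a := fun x => |x| / 4 * (1 + |x|)) ?_ ?_
  · exact eventually_nhdsWithin_of_forall hb
  · have : Continuous fun x : ℝ => |x| / 4 * (1 + |x|) := by fun_prop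
    have h := this.tendsto 0
    simp only [abs_zero, zero_div, zero_mul] at h
    exact h.mono_left nhdsWithin_le_nhds

lemma rPhi_neg (γ φ : ℝ) : rPhi γ (-φ) = rPhi γ φ := by simp [rPhi]

@[simp] lemma rPhi_zero (γ : ℝ) : rPhi γ 0 = γ := by simp [rPhi]

lemma sinh_rPhi (γ φ : ℝ) : Real.sinh (rPhi γ φ) = Real.sinh γ / Real.sinc φ := by simp [rPhi]

/-- This is the equation `Im α(r + iφ) = 0` that defines the path. -/
lemma sinh_rPhi_mul_sin (γ : ℝ) {φ : ℝ} (hφ : φ ∈ Ioo (-Real.pi) Real.pi) :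
    Real.sinh (rPhi γ φ) * Real.sin φ = Real.sinh γ * φ := by
  have := (sinc_pos hφ).ne'
  rw [sinh_rPhi, ← sinc_mul_self]
  field_simp

lemma continuousAt_rPhi (γ : ℝ) {φ : ℝ} (hφ : φ ∈ Ioo (-Real.pi) Real.pi) :
    ContinuousAt (rPhi γ) φ := by
  unfold rPhi
  exact (continuousAt_const.div Real.continuous_sinc.continuousAt (sinc_pos hφ).ne').arsinh

lemma hasDerivAt_rPhi_zero (γ : ℝ) : HasDerivAt (rPhi γ) 0 0 := by
  have h := ((hasDerivAt_const (0 : ℝ) (Real.sinh γ)).div hasDerivAt_sinc_zero (by simp)).arsinh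
  simpa using! h

lemma Ioo_zero_pi_subset : Ioo 0 Real.pi ⊆ Ioo (-Real.pi) Real.pi :=
  Ioo_subset_Ioo_left (by linarith [Real.pi_pos])

lemma hasDerivAt_rPhi {γ : ℝ} (hγ : 0 < γ) {φ : ℝ} (hφ : φ ∈ Ioo 0 Real.pi) :
    HasDerivAt (rPhi γ) (rPhi' γ φ) φ := by
  have hs : 0 < Real.sinh γ := Real.sinh_pos_iff.2 hγ
  have hsin : 0 < Real.sin φ := Real.sin_pos_of_pos_of_lt_pi hφ.1 hφ.2
  have hφ0 : φ ≠ 0 := hφ.1.ne'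
  have h1 : HasDerivAt (fun x => Real.arsinh (Real.sinh γ * x / Real.sin x))
      (((√(1 + (Real.sinh γ * φ / Real.sin φ) ^ 2))⁻¹) *
      ((Real.sinh γ * Real.sin φ - Real.sinh γ * φ * Real.cos φ) / Real.sin φ ^ 2)) φ := by
    have h2 : HasDerivAt (fun x => Real.sinh γ * x / Real.sin x)
        ((Real.sinh γ * Real.sin φ - Real.sinh γ * φ * Real.cos φ) / Real.sin φ ^ 2) φ := by
      simpa using! ((hasDerivAt_id φ).const_mul (Real.sinh γ)).div (Real.hasDerivAt_sin φ) hsin.ne'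
    simpa [smul_eq_mul] using h2.arsinh
  have heq : rPhi γ =ᶠ[𝓝 φ] fun x => Real.arsinh (Real.sinh γ * x / Real.sin x) := by
    filter_upwards [isOpen_Ioo.mem_nhds hφ] with x hx
    have : Real.sin x ≠ 0 := (Real.sin_pos_of_pos_of_lt_pi hx.1 hx.2).ne'
    have hx0 : x ≠ 0 := hx.1.ne'
    rw [rPhi, Real.sinc_of_ne_zero hx0]
    congr 1
    field_simp
  refine (h1.congr_of_eventuallyEq heq).congr_deriv ?_
  -- Pulling `sinh γ / sinc φ` out of the root leaves the denominator of `rPhi'`.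
  have e : √(1 + (Real.sinh γ * φ / Real.sin φ) ^ 2) =
      Real.sinh γ * φ / Real.sin φ * √(1 + Real.sinc φ ^ 2 / Real.sinh γ ^ 2) := by
    have hp : 0 < Real.sinh γ * φ / Real.sin φ := div_pos (mul_pos hs hφ.1) hsin
    rw [← Real.sqrt_sq hp.le, ← Real.sqrt_mul (sq_nonneg _), Real.sqrt_sq hp.le,
      Real.sinc_of_ne_zero hφ0]
    congr 1
    field_simp
    ring
  have hq : 0 < √(1 + Real.sinc φ ^ 2 / Real.sinh γ ^ 2) := Real.sqrt_pos.2 (by positivity)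
  rw [e, rPhi', Real.cot_eq_cos_div_sin]
  field_simp

lemma le_rPhi {γ : ℝ} (hγ : 0 < γ) {φ : ℝ} (hφ : φ ∈ Ioo (-Real.pi) Real.pi) : γ ≤ rPhi γ φ := by
  rw [← Real.sinh_le_sinh, sinh_rPhi, le_div_iff₀ (sinc_pos hφ)]
  have := Real.sinh_pos_iff.2 hγ
  nlinarith [Real.sinc_le_one φ]

lemma tendsto_rPhi_pi {γ : ℝ} (hγ : 0 < γ) : Tendsto (rPhi γ) (𝓝[<] Real.pi) atTop := by
  have h1 : Tendsto Real.sinc (𝓝[<] Real.pi) (𝓝[>] 0) := by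
    refine tendsto_nhdsWithin_of_tendsto_nhds_of_eventually_within _ ?_ ?_
    · have h := Real.continuous_sinc.tendsto Real.pi
      rw [Real.sinc_of_ne_zero Real.pi_pos.ne', Real.sin_pi, zero_div] at h
      exact h.mono_left nhdsWithin_le_nhds
    · filter_upwards [Ioo_mem_nhdsLT Real.pi_pos] with x hx
      exact sinc_pos (Ioo_zero_pi_subset hx)
  have h2 : Tendsto (fun φ => Real.sinh γ / Real.sinc φ) (𝓝[<] Real.pi) atTop := by
    simp_rw [div_eq_mul_inv]
    exact (tendsto_inv_nhdsGT_zero.comp h1).const_mul_atTop (Real.sinh_pos_iff.2 hγ)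
  exact (Real.sinhOrderIso.symm.tendsto_atTop).comp h2

lemma hPhi_eq (γ φ : ℝ) : hPhi γ φ =
    Real.cosh γ - Real.cosh (rPhi γ φ) * Real.cos φ + Real.sinh γ * (rPhi γ φ - γ) := by
  unfold hPhi alpha; ring

lemma hPhi_neg (γ φ : ℝ) : hPhi γ (-φ) = hPhi γ φ := by simp [hPhi, rPhi_neg]

@[simp] lemma hPhi_zero (γ : ℝ) : hPhi γ 0 = 0 := by simp [hPhi, alpha]

lemma hPhi'_pos (γ : ℝ) {φ : ℝ} (hφ : φ ∈ Ioo 0 Real.pi) : 0 < hPhi' γ φ := by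
  have := Real.sin_pos_of_pos_of_lt_pi hφ.1 hφ.2
  have := Real.cosh_pos (rPhi γ φ)
  unfold hPhi'
  positivity

lemma hasDerivAt_hPhi {γ : ℝ} (hγ : 0 < γ) {φ : ℝ} (hφ : φ ∈ Ioo 0 Real.pi) :
    HasDerivAt (hPhi γ) (hPhi' γ φ) φ := by
  have hr := hasDerivAt_rPhi hγ hφ
  have h1 := ((hr.cosh.mul (Real.hasDerivAt_cos φ)).const_sub (Real.cosh γ)).add
    ((hr.sub_const γ).const_mul (Real.sinh γ))
  -- Differentiating the path equation `sinh r · sin φ = φ sinh γ` makes the coefficient of `r'` in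
  -- the derivative of `h` equal to `sin φ cosh r · r'`, whence the factor `1 + r'²`.
  have key : Real.sinh γ - Real.sinh (rPhi γ φ) * Real.cos φ =
      Real.sin φ * Real.cosh (rPhi γ φ) * rPhi' γ φ := by
    have h2 := hr.sinh.mul (Real.hasDerivAt_sin φ)
    have h3 : HasDerivAt (fun x => Real.sinh γ * x) (Real.sinh γ) φ := by
      simpa using (hasDerivAt_id φ).const_mul (Real.sinh γ)
    have h4 : (fun x => Real.sinh γ * x) =ᶠ[𝓝 φ] (fun x => Real.sinh (rPhi γ x)) * Real.sin := by
      filter_upwards [isOpen_Ioo.mem_nhds hφ] with x hx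
      exact (sinh_rPhi_mul_sin γ (Ioo_zero_pi_subset hx)).symm
    have := h2.unique (h3.congr_of_eventuallyEq h4.symm)
    linarith
  rw [show hPhi γ = fun x => Real.cosh γ - Real.cosh (rPhi γ x) * Real.cos x +
      Real.sinh γ * (rPhi γ x - γ) from funext (hPhi_eq γ)]
  refine HasDerivAt.congr_deriv h1 ?_
  unfold hPhi'
  linear_combination (rPhi' γ φ) * key

lemma continuousAt_hPhi (γ : ℝ) {φ : ℝ} (hφ : φ ∈ Ioo (-Real.pi) Real.pi) :
    ContinuousAt (hPhi γ) φ := by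
  have := continuousAt_rPhi γ hφ
  rw [show hPhi γ = fun x => Real.cosh γ - Real.cosh (rPhi γ x) * Real.cos x +
      Real.sinh γ * (rPhi γ x - γ) from funext (hPhi_eq γ)]
  have h2 : ContinuousAt (fun x => Real.cosh (rPhi γ x)) φ :=
    Real.continuous_cosh.continuousAt.comp this
  exact (continuousAt_const.sub (h2.mul Real.continuous_cos.continuousAt)).add
    (continuousAt_const.mul (this.sub continuousAt_const))

lemma strictMonoOn_hPhi {γ : ℝ} (hγ : 0 < γ) : StrictMonoOn (hPhi γ) (Ico 0 Real.pi) := by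
  refine strictMonoOn_of_deriv_pos (convex_Ico _ _) ?_ ?_
  · exact fun x hx => (continuousAt_hPhi γ ⟨by linarith [hx.1, Real.pi_pos], hx.2⟩).continuousWithinAt
  · rw [interior_Ico]
    intro x hx
    rw [(hasDerivAt_hPhi hγ hx).deriv]
    exact hPhi'_pos γ hx

lemma hPhi_pos {γ : ℝ} (hγ : 0 < γ) {φ : ℝ} (hφ : φ ∈ Ioo 0 Real.pi) : 0 < hPhi γ φ := by
  simpa using strictMonoOn_hPhi hγ ⟨le_rfl, Real.pi_pos⟩ ⟨hφ.1.le, hφ.2⟩ hφ.1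

lemma tendsto_hPhi_pi {γ : ℝ} (hγ : 0 < γ) : Tendsto (hPhi γ) (𝓝[<] Real.pi) atTop := by
  have h1 : Tendsto (fun φ => Real.sinh γ * (rPhi γ φ - γ)) (𝓝[<] Real.pi) atTop :=
    (tendsto_atTop_add_const_right _ (-γ) (tendsto_rPhi_pi hγ)).const_mul_atTop
      (Real.sinh_pos_iff.2 hγ)
  refine tendsto_atTop_mono' _ ?_ h1
  -- Beyond `π/2` the cosine term helps, so `h` dominates `sinh γ (r - γ)`.
  filter_upwards [Ioo_mem_nhdsLT (show Real.pi / 2 < Real.pi by linarith [Real.pi_pos])] with x hx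
  rw [hPhi_eq]
  have : Real.cos x ≤ 0 := Real.cos_nonpos_of_pi_div_two_le_of_le hx.1.le (by linarith [hx.2, Real.pi_pos])
  nlinarith [Real.cosh_pos γ, Real.cosh_pos (rPhi γ x)]

@[simp] lemma uPhi_zero (γ : ℝ) : uPhi γ 0 = 0 := by simp [uPhi]

lemma uPhi_pos {γ : ℝ} (hγ : 0 < γ) {φ : ℝ} (hφ : φ ∈ Ioo 0 Real.pi) : 0 < uPhi γ φ :=
  Real.sqrt_pos.2 (by linarith [hPhi_pos hγ hφ])

lemma uPhi_sq {γ : ℝ} (hγ : 0 < γ) {φ : ℝ} (hφ : φ ∈ Ioo 0 Real.pi) :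
    uPhi γ φ ^ 2 = 2 * hPhi γ φ :=
  Real.sq_sqrt (by linarith [hPhi_pos hγ hφ])

lemma hasDerivAt_uPhi {γ : ℝ} (hγ : 0 < γ) {φ : ℝ} (hφ : φ ∈ Ioo 0 Real.pi) :
    HasDerivAt (uPhi γ) (hPhi' γ φ / uPhi γ φ) φ := by
  have hp := hPhi_pos hγ hφ
  refine (((hasDerivAt_hPhi hγ hφ).const_mul 2).sqrt (by positivity)).congr_deriv ?_
  rw [mul_div_mul_left _ _ two_ne_zero]
  rfl

lemma strictMonoOn_uPhi {γ : ℝ} (hγ : 0 < γ) : StrictMonoOn (uPhi γ) (Ico 0 Real.pi) := by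
  intro x hx y hy hxy
  have h := strictMonoOn_hPhi hγ hx hy hxy
  have h0 := (strictMonoOn_hPhi hγ).monotoneOn ⟨le_rfl, Real.pi_pos⟩ hx hx.1
  rw [hPhi_zero] at h0
  exact Real.sqrt_lt_sqrt (by linarith) (by linarith)

lemma continuousOn_uPhi (γ : ℝ) : ContinuousOn (uPhi γ) (Ico 0 Real.pi) := fun x hx =>
  ((continuousAt_hPhi γ ⟨by linarith [hx.1, Real.pi_pos], hx.2⟩).const_mul 2).sqrt.continuousWithinAt

lemma tendsto_uPhi_pi {γ : ℝ} (hγ : 0 < γ) : Tendsto (uPhi γ) (𝓝[<] Real.pi) atTop :=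
  Real.tendsto_sqrt_atTop.comp ((tendsto_hPhi_pi hγ).const_mul_atTop two_pos)

lemma uPhi_image {γ : ℝ} (hγ : 0 < γ) : uPhi γ '' Ioo 0 Real.pi = Ioi 0 := by
  ext w
  constructor
  · rintro ⟨φ, hφ, rfl⟩
    exact uPhi_pos hγ hφ
  · intro hw
    have hw : 0 < w := hw
    obtain ⟨b, hb1, hb2⟩ := (((tendsto_uPhi_pi hγ).eventually_gt_atTop w).and
      (Ioo_mem_nhdsLT Real.pi_pos)).exists
    have h := intermediate_value_Icc hb2.1.le ((continuousOn_uPhi γ).mono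
      (Icc_subset_Ico_right hb2.2))
    obtain ⟨c, hc, rfl⟩ := h ⟨by rw [uPhi_zero]; exact hw.le, hb1.le⟩
    refine ⟨c, ⟨hc.1.lt_of_ne ?_, hc.2.trans_lt hb2.2⟩, rfl⟩
    rintro rfl
    simp at hw

/-- Substituting `w = u(φ)`, a bijection of `(0, π)` onto `(0, ∞)` with `2h = w²`, turns this into
the Gaussian moment `∫₀^∞ w^{2k} e^{-b w²} dw`. -/
lemma exp_mul_uPhi_pow {γ : ℝ} (hγ : 0 < γ) {b : ℝ} (hb : 0 < b) (k : ℕ) :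
    IntegrableOn (fun φ => Real.exp (-(2 * b) * hPhi γ φ) *
      (uPhi γ φ ^ (2 * k) * (hPhi' γ φ / uPhi γ φ))) (Ioo 0 Real.pi) ∧
    ∫ φ in Ioo 0 Real.pi, Real.exp (-(2 * b) * hPhi γ φ) *
      (uPhi γ φ ^ (2 * k) * (hPhi' γ φ / uPhi γ φ)) =
      1 / 2 * Real.Gamma (k + 1 / 2) * (b⁻¹) ^ ((k : ℝ) + 1 / 2) := by
  have hd : ∀ φ ∈ Ioo 0 Real.pi, HasDerivWithinAt (uPhi γ) (hPhi' γ φ / uPhi γ φ)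
      (Ioo 0 Real.pi) φ := fun φ hφ => (hasDerivAt_uPhi hγ hφ).hasDerivWithinAt
  have hinj : InjOn (uPhi γ) (Ioo 0 Real.pi) :=
    (strictMonoOn_uPhi hγ).injOn.mono Ioo_subset_Ico_self
  have hk : (-1 : ℝ) < 2 * k := by
    have : (0 : ℝ) ≤ k := k.cast_nonneg
    linarith
  have hpt : ∀ φ ∈ Ioo 0 Real.pi, |hPhi' γ φ / uPhi γ φ| •
      (uPhi γ φ ^ (2 * (k : ℝ)) * Real.exp (-b * uPhi γ φ ^ (2 : ℝ))) =
      Real.exp (-(2 * b) * hPhi γ φ) * (uPhi γ φ ^ (2 * k) * (hPhi' γ φ / uPhi γ φ)) := by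
    intro φ hφ
    have hu := uPhi_pos hγ hφ
    rw [abs_of_pos (div_pos (hPhi'_pos γ hφ) hu), Real.rpow_two, uPhi_sq hγ hφ,
      show (2 * (k : ℝ)) = ((2 * k : ℕ) : ℝ) by push_cast; ring, Real.rpow_natCast, smul_eq_mul,
      show -b * (2 * hPhi γ φ) = -(2 * b) * hPhi γ φ by ring]
    ring
  constructor
  · have h := (integrableOn_image_iff_integrableOn_abs_deriv_smul measurableSet_Ioo hd hinj
      (fun w => w ^ (2 * (k : ℝ)) * Real.exp (-b * w ^ (2 : ℝ)))).1 (by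
        rw [uPhi_image hγ]
        exact integrableOn_rpow_mul_exp_neg_mul_rpow hk two_pos hb)
    exact h.congr_fun hpt measurableSet_Ioo
  · rw [← setIntegral_congr_fun measurableSet_Ioo hpt,
      ← integral_image_eq_integral_abs_deriv_smul measurableSet_Ioo hd hinj
      (fun w => w ^ (2 * (k : ℝ)) * Real.exp (-b * w ^ (2 : ℝ))), uPhi_image hγ,
      integral_rpow_mul_exp_neg_mul_rpow two_pos hk hb, Real.inv_rpow hb.le, ← Real.rpow_neg hb.le,
      show -(2 * (k : ℝ) + 1) / 2 = -((k : ℝ) + 1 / 2) by ring,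
      show (2 * (k : ℝ) + 1) / 2 = (k : ℝ) + 1 / 2 by ring]
    ring

/-! ### The function `t` near the saddle point -/

/-- The point with argument `φ` of the path of steepest descent. -/
noncomputable def descentPath (γ φ : ℝ) : ℂ := Complex.exp (rPhi γ φ + φ * Complex.I)

/-- The odd extension of `uPhi`. -/
noncomputable def signedU (γ φ : ℝ) : ℝ := Real.sign φ * uPhi γ φ

lemma log_descentPath {γ φ : ℝ} (hφ : φ ∈ Ioo (-Real.pi) Real.pi) :
    Complex.log (descentPath γ φ) = rPhi γ φ + φ * Complex.I := by
  rw [descentPath, Complex.log_exp] <;> simp [hφ.1, hφ.2.le]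

lemma alphaC_re_add_im (γ r φ : ℝ) : alphaC γ (r + φ * Complex.I) =
    ((Real.cosh γ - Real.cosh r * Real.cos φ + Real.sinh γ * (r - γ) : ℝ) : ℂ) +
    ((Real.sinh γ * φ - Real.sinh r * Real.sin φ : ℝ) : ℂ) * Complex.I := by
  rw [alphaC, Complex.cosh_add, Complex.cosh_mul_I, Complex.sinh_mul_I]
  push_cast
  ring

lemma alphaC_log_descentPath {γ φ : ℝ} (hφ : φ ∈ Ioo (-Real.pi) Real.pi) :
    alphaC γ (Complex.log (descentPath γ φ)) = hPhi γ φ := by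
  rw [log_descentPath hφ, alphaC_re_add_im, sinh_rPhi_mul_sin γ hφ, hPhi_eq]
  simp

lemma descentPath_im (γ φ : ℝ) :
    (descentPath γ φ).im = Real.exp (rPhi γ φ) * Real.sin φ := by
  simp [descentPath, Complex.exp_im]

lemma descentPath_re (γ φ : ℝ) :
    (descentPath γ φ).re = Real.exp (rPhi γ φ) * Real.cos φ := by
  simp [descentPath, Complex.exp_re]

lemma uPhi_neg (γ φ : ℝ) : uPhi γ (-φ) = uPhi γ φ := by simp [uPhi, hPhi_neg]

lemma uPhi_abs (γ φ : ℝ) : uPhi γ |φ| = uPhi γ φ := by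
  rcases abs_choice φ with h | h <;> simp [h, uPhi_neg]

lemma hPhi_nonneg {γ : ℝ} (hγ : 0 < γ) {φ : ℝ} (hφ : φ ∈ Ioo (-Real.pi) Real.pi) :
    0 ≤ hPhi γ φ := by
  rcases lt_trichotomy φ 0 with h | rfl | h
  · rw [← hPhi_neg]
    exact (hPhi_pos hγ ⟨by linarith, by linarith [hφ.1]⟩).le
  · simp
  · exact (hPhi_pos hγ ⟨h, hφ.2⟩).le

lemma sign_sin {φ : ℝ} (hφ : φ ∈ Ioo (-Real.pi) Real.pi) :
    Real.sign (Real.sin φ) = Real.sign φ := by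
  rcases lt_trichotomy φ 0 with h | rfl | h
  · rw [Real.sign_of_neg h, Real.sign_of_neg (Real.sin_neg_of_neg_of_neg_pi_lt h hφ.1)]
  · simp
  · rw [Real.sign_of_pos h, Real.sign_of_pos (Real.sin_pos_of_pos_of_lt_pi h hφ.2)]

lemma sign_mul_of_pos {x y : ℝ} (hx : 0 < x) : Real.sign (x * y) = Real.sign y := by
  rcases lt_trichotomy y 0 with h | rfl | h
  · rw [Real.sign_of_neg h, Real.sign_of_neg (mul_neg_of_pos_of_neg hx h)]
  · simp
  · rw [Real.sign_of_pos h, Real.sign_of_pos (mul_pos hx h)]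

lemma tInv_descentPath {γ : ℝ} (hγ : 0 < γ) {φ : ℝ} (hφ : φ ∈ Ioo (-Real.pi) Real.pi) :
    tInv γ (descentPath γ φ) = signedU γ φ := by
  rw [tInv, alphaC_log_descentPath hφ, descentPath_im, sign_mul_of_pos (Real.exp_pos _),
    sign_sin hφ, signedU, uPhi, Real.sqrt_eq_rpow, Complex.ofReal_mul, Complex.ofReal_cpow
      (mul_nonneg zero_le_two (hPhi_nonneg hγ hφ))]
  norm_num

/-- A nonzero real value of `tInv` makes `2α(ln x) = w²` real. Off the real axis, vanishing of the
imaginary part determines `ln |x|` from `arg x`, which puts `x` on the path. -/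
lemma eq_descentPath_of_tInv {γ : ℝ} (hγ : 0 < γ) {x : ℂ} {w : ℝ} (hw : w ≠ 0)
    (h : tInv γ x = w) :
    ∃ φ ∈ Ioo (-Real.pi) Real.pi, x = descentPath γ φ ∧ signedU γ φ = w := by
  have him : x.im ≠ 0 := by
    intro h0
    rw [tInv, h0, Real.sign_zero] at h
    simp at h
    exact hw (by exact_mod_cast h.symm)
  have hx0 : x ≠ 0 := by rintro rfl; simp at him
  have hB : Complex.arg x ∈ Ioo (-Real.pi) Real.pi := by
    refine ⟨Complex.neg_pi_lt_arg x, (Complex.arg_le_pi x).lt_of_ne ?_⟩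
    intro h0
    exact him (Complex.arg_eq_pi_iff.1 h0).2
  have hB0 : Complex.arg x ≠ 0 := fun h0 => him (Complex.arg_eq_zero_iff.1 h0).2
  have hsin : Real.sin (Complex.arg x) ≠ 0 := by
    rw [← sinc_mul_self]
    exact mul_ne_zero (sinc_pos hB).ne' hB0
  have hlog : Complex.log x = (Real.log ‖x‖ : ℝ) + (Complex.arg x : ℝ) * Complex.I := rfl
  -- Squaring removes both the sign and the branch of the root.
  have hsq : 2 * alphaC γ (Complex.log x) = ((w ^ 2 : ℝ) : ℂ) := by
    have h1 : (((2 * alphaC γ (Complex.log x)) ^ (1 / 2 : ℂ)) ^ 2 : ℂ) =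
        2 * alphaC γ (Complex.log x) := by
      have := Complex.cpow_nat_inv_pow (2 * alphaC γ (Complex.log x)) two_ne_zero
      rw [one_div]
      exact_mod_cast this
    have h2 : ((Real.sign x.im : ℂ)) ^ 2 = 1 := by
      rcases Real.sign_apply_eq_of_ne_zero _ him with h | h <;> simp [h]
    rw [Complex.ofReal_pow, ← h, tInv, mul_pow, h1, h2, one_mul]
  have him2 : Real.sinh γ * Complex.arg x - Real.sinh (Real.log ‖x‖) * Real.sin (Complex.arg x)
      = 0 := by
    have key : ∀ A B C : ℝ, 2 * ((A : ℂ) + B * Complex.I) = C → B = 0 := fun A B C h => by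
      simpa using congrArg Complex.im h
    rw [hlog, alphaC_re_add_im] at hsq
    exact key _ _ _ hsq
  have hr : Real.log ‖x‖ = rPhi γ (Complex.arg x) := by
    apply Real.sinh_injective
    rw [← mul_left_inj' hsin, sinh_rPhi_mul_sin γ hB]
    linarith
  have hxe : x = descentPath γ (Complex.arg x) := by
    rw [descentPath, ← hr, ← hlog, Complex.exp_log hx0]
  refine ⟨_, hB, hxe, ?_⟩
  rw [hxe, tInv_descentPath hγ hB] at h
  exact_mod_cast h

lemma abs_signedU {γ φ : ℝ} (h : φ ≠ 0) : |signedU γ φ| = uPhi γ |φ| := by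
  rw [signedU, abs_mul, uPhi_abs, abs_of_nonneg (a := uPhi γ φ) (Real.sqrt_nonneg _)]
  rcases Real.sign_apply_eq_of_ne_zero _ h with h | h <;> simp [h]

lemma abs_mem {φ : ℝ} (hφ : φ ∈ Ioo (-Real.pi) Real.pi) : |φ| ∈ Ico 0 Real.pi :=
  ⟨abs_nonneg _, abs_lt.2 hφ⟩

lemma signedU_surj {γ : ℝ} (hγ : 0 < γ) (w : ℝ) :
    ∃ φ ∈ Ioo (-Real.pi) Real.pi, signedU γ φ = w := by
  rcases lt_trichotomy w 0 with h | rfl | h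
  · obtain ⟨φ, hφ, h1⟩ := (uPhi_image hγ).symm.subset (show -w ∈ Ioi 0 by simpa using h)
    refine ⟨-φ, ⟨by linarith [hφ.2], by linarith [hφ.1, Real.pi_pos]⟩, ?_⟩
    rw [signedU, uPhi_neg, h1, Real.sign_of_neg (by linarith [hφ.1])]
    ring
  · exact ⟨0, ⟨by linarith [Real.pi_pos], Real.pi_pos⟩, by simp [signedU]⟩
  · obtain ⟨φ, hφ, h1⟩ := (uPhi_image hγ).symm.subset (show w ∈ Ioi 0 from h)
    exact ⟨φ, Ioo_zero_pi_subset hφ, by rw [signedU, Real.sign_of_pos hφ.1, h1, one_mul]⟩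

lemma sign_signedU {γ : ℝ} (hγ : 0 < γ) {φ : ℝ} (hφ : φ ∈ Ioo (-Real.pi) Real.pi) :
    Real.sign (signedU γ φ) = Real.sign φ := by
  rcases lt_trichotomy φ 0 with h | rfl | h
  · have := uPhi_pos hγ (φ := -φ) ⟨by linarith, by linarith [hφ.1]⟩
    rw [uPhi_neg] at this
    rw [signedU, Real.sign_of_neg h, Real.sign_of_neg (by linarith)]
  · simp [signedU]
  · have := uPhi_pos hγ ⟨h, hφ.2⟩
    rw [signedU, Real.sign_of_pos h, Real.sign_of_pos (by linarith)]

lemma sign_mul_abs_self (x : ℝ) : Real.sign x * |x| = x := by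
  rcases lt_trichotomy x 0 with h | rfl | h
  · rw [Real.sign_of_neg h, abs_of_neg h]; ring
  · simp
  · rw [Real.sign_of_pos h, abs_of_pos h, one_mul]

lemma signedU_injOn {γ : ℝ} (hγ : 0 < γ) : InjOn (signedU γ) (Ioo (-Real.pi) Real.pi) := by
  intro x hx y hy hxy
  have hs : Real.sign x = Real.sign y := by
    rw [← sign_signedU hγ hx, ← sign_signedU hγ hy, hxy]
  by_cases h0 : x = 0
  · subst h0
    rw [Real.sign_zero] at hs
    exact (Real.sign_eq_zero_iff.1 hs.symm).symm
  have h1 : y ≠ 0 := by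
    rintro rfl
    rw [Real.sign_zero] at hs
    exact h0 (Real.sign_eq_zero_iff.1 hs)
  have h2 : |x| = |y| := by
    apply (strictMonoOn_uPhi hγ).injOn (abs_mem hx) (abs_mem hy)
    rw [← abs_signedU h0, ← abs_signedU h1, hxy]
  rw [← sign_mul_abs_self x, ← sign_mul_abs_self y, hs, h2]

/-- The choice made by `Function.invFun` is forced for nonzero arguments. At `0` it would not be,
because `tInv` vanishes on the whole real axis; there the prescribed value `e^γ` is used. -/
lemma tFun_signedU {γ : ℝ} (hγ : 0 < γ) {φ : ℝ} (hφ : φ ∈ Ioo (-Real.pi) Real.pi) :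
    tFun γ (signedU γ φ) = descentPath γ φ := by
  by_cases h0 : signedU γ φ = 0
  · have : φ = 0 := signedU_injOn hγ hφ ⟨by linarith [Real.pi_pos], Real.pi_pos⟩ (by
      rw [h0]; simp [signedU])
    subst this
    simp [tFun, h0, descentPath]
  · rw [tFun, if_neg h0]
    obtain ⟨ψ, hψ, h1, h2⟩ := eq_descentPath_of_tInv hγ h0
      (Function.invFun_eq ⟨descentPath γ φ, tInv_descentPath hγ hφ⟩)
    rw [h1, signedU_injOn hγ hψ hφ h2]

/-! ### Behaviour at the saddle point and the value of `c₀` -/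

lemma abs_alpha_le {γ x : ℝ} (h : γ ≤ x) :
    |alpha γ x| ≤ (Real.sinh x - Real.sinh γ) * (x - γ) := by
  rcases h.eq_or_lt with rfl | h
  · simp [alpha]
  have hd : ∀ y, HasDerivAt (alpha γ) (-Real.sinh y + Real.sinh γ) y := by
    intro y
    have := ((Real.hasDerivAt_cosh y).const_sub (Real.cosh γ)).add
      (((hasDerivAt_id y).sub_const γ).const_mul (Real.sinh γ))
    simpa using! this
  obtain ⟨c, hc, hc2⟩ := exists_hasDerivAt_eq_slope (alpha γ) _ h
    (fun y _ => (hd y).continuousAt.continuousWithinAt) (fun y _ => hd y)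
  have h0 : alpha γ γ = 0 := by simp [alpha]
  rw [h0, sub_zero, eq_div_iff (by linarith)] at hc2
  have h1 := Real.sinh_lt_sinh.2 hc.1
  have h2 := Real.sinh_lt_sinh.2 hc.2
  rw [← hc2, abs_mul, abs_of_pos (sub_pos.2 h), abs_of_nonpos (by linarith)]
  gcongr
  linarith

lemma one_sub_cos_eq (φ : ℝ) : 1 - Real.cos φ = φ ^ 2 * (Real.sinc (φ / 2) ^ 2 / 2) := by
  have h := Real.cos_sq' (φ / 2)
  have h2 := Real.cos_sq (φ / 2)
  have h3 := sinc_mul_self (φ / 2)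
  rw [mul_div_cancel₀ _ two_ne_zero] at h2
  rw [h2, ← h3] at h
  linear_combination -2 * h

/-- The limit comes from `(1 - cos φ) cosh r`. The rest, `α(r(φ))`, is `o(φ²)`: by `abs_alpha_le` it
is at most `(sinh r - sinh γ)(r - γ)`, and both factors are `o(φ)` because `r` has zero derivative
at `0`. -/
lemma tendsto_two_mul_hPhi_div_sq {γ : ℝ} (hγ : 0 < γ) :
    Tendsto (fun φ => 2 * hPhi γ φ / φ ^ 2) (𝓝[≠] 0) (𝓝 (Real.cosh γ)) := by
  have h1 : Tendsto (fun φ => Real.sinc (φ / 2) ^ 2 * Real.cosh (rPhi γ φ)) (𝓝[≠] 0)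
      (𝓝 (Real.cosh γ)) := by
    have hc : ContinuousAt (fun φ => Real.sinc (φ / 2) ^ 2 * Real.cosh (rPhi γ φ)) 0 := by
      have := (hasDerivAt_rPhi_zero γ).continuousAt
      exact ContinuousAt.mul (by fun_prop) (Real.continuous_cosh.continuousAt.comp this)
    simpa using! hc.tendsto.mono_left nhdsWithin_le_nhds
  have h2 : Tendsto (fun φ => 2 * alpha γ (rPhi γ φ) / φ ^ 2) (𝓝[≠] 0) (𝓝 0) := by
    have hr := hasDerivAt_iff_tendsto_slope.1 (hasDerivAt_rPhi_zero γ)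
    have hs := hasDerivAt_iff_tendsto_slope.1 (hasDerivAt_rPhi_zero γ).sinh
    have hm := (hs.mul hr).const_mul 2
    simp only [mul_zero] at hm
    refine squeeze_zero_norm' ?_ hm
    have hI : Ioo (-Real.pi) Real.pi ∈ 𝓝[≠] (0 : ℝ) := mem_nhdsWithin_of_mem_nhds
      (Ioo_mem_nhds (by linarith [Real.pi_pos]) Real.pi_pos)
    filter_upwards [hI, self_mem_nhdsWithin] with φ hφ h0
    have h0 : φ ≠ 0 := h0
    have h := abs_alpha_le (le_rPhi hγ hφ)
    rw [Real.norm_eq_abs, abs_div, abs_mul, abs_two, abs_of_pos (a := φ ^ 2) (by positivity),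
      slope_def_field, slope_def_field, rPhi_zero, sub_zero]
    calc _ ≤ 2 * ((Real.sinh (rPhi γ φ) - Real.sinh γ) * (rPhi γ φ - γ)) / φ ^ 2 := by gcongr
      _ = _ := by field_simp
  have h3 := h1.add h2
  rw [add_zero] at h3
  refine h3.congr' ?_
  filter_upwards [self_mem_nhdsWithin] with φ h0
  have h0 : φ ≠ 0 := h0
  rw [hPhi, one_sub_cos_eq]
  field_simp

lemma hasDerivAt_signedU_zero {γ : ℝ} (hγ : 0 < γ) :
    HasDerivAt (signedU γ) (√(Real.cosh γ)) 0 := by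
  rw [hasDerivAt_iff_tendsto_slope]
  refine ((Real.continuous_sqrt.tendsto _).comp (tendsto_two_mul_hPhi_div_sq hγ)).congr' ?_
  filter_upwards [self_mem_nhdsWithin] with φ h0
  have h0 : φ ≠ 0 := h0
  have : signedU γ 0 = 0 := by simp [signedU]
  rw [slope_def_field, this, sub_zero, sub_zero, Function.comp_apply,
    Real.sqrt_div' _ (sq_nonneg φ), Real.sqrt_sq_eq_abs, signedU, uPhi]
  have h1 : |φ| = φ.sign * φ := by
    rcases lt_or_gt_of_ne h0 with h | h
    · rw [abs_of_neg h, Real.sign_of_neg h, neg_one_mul]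
    · rw [abs_of_pos h, Real.sign_of_pos h, one_mul]
  rw [h1]
  rcases Real.sign_apply_eq_of_ne_zero _ h0 with h | h <;> rw [h] <;> field_simp

/-- Here `t` is the path composed with the inverse `ψ` of the odd function `signedU`. The inverse is
differentiable at `0` because `signedU` has the nonzero derivative `√(cosh γ)` there and `ψ` is
continuous at `0` by monotonicity of `uPhi`. -/
lemma hasDerivAt_tFun_zero {γ : ℝ} (hγ : 0 < γ) :
    HasDerivAt (tFun γ) (Complex.I * (Real.exp γ / √(Real.cosh γ) : ℝ)) 0 := by
  choose ψ hψ hψu using signedU_surj hγ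
  have hψ0 : ψ 0 = 0 := signedU_injOn hγ (hψ 0) ⟨by linarith [Real.pi_pos], Real.pi_pos⟩ (by
      rw [hψu]; simp [signedU])
  have hc : ContinuousAt ψ 0 := by
    rw [Metric.continuousAt_iff]
    intro ε hε
    set δ := min (ε / 2) (Real.pi / 2)
    have hδ : δ ∈ Ioo 0 Real.pi := ⟨lt_min (by linarith) (by linarith [Real.pi_pos]),
      (min_le_right _ _).trans_lt (by linarith [Real.pi_pos])⟩
    refine ⟨uPhi γ δ, uPhi_pos hγ hδ, fun w hw => ?_⟩
    rw [Real.dist_eq, sub_zero] at hw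
    rw [hψ0, Real.dist_eq, sub_zero]
    by_contra! hcon
    have h0 : ψ w ≠ 0 := by
      intro h; rw [h, abs_zero] at hcon; linarith
    have h1 : uPhi γ δ ≤ uPhi γ |ψ w| := (strictMonoOn_uPhi hγ).monotoneOn
      (Ioo_subset_Ico_self hδ) (abs_mem (hψ w))
      (((min_le_left _ _).trans (by linarith)).trans hcon)
    rw [← abs_signedU h0, hψu] at h1
    linarith
  have hsq : √(Real.cosh γ) ≠ 0 := (Real.sqrt_pos.2 (Real.cosh_pos γ)).ne'
  have hψd : HasDerivAt ψ (√(Real.cosh γ))⁻¹ 0 :=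
    HasDerivAt.of_local_left_inverse hc (by rw [hψ0]; exact hasDerivAt_signedU_zero hγ) hsq
      (Eventually.of_forall hψu)
  have hX : HasDerivAt (descentPath γ) (Complex.exp γ * Complex.I) (ψ 0) := by
    rw [hψ0]
    have h1 := (hasDerivAt_rPhi_zero γ).ofReal_comp
    have h2 := ((hasDerivAt_id (0 : ℝ)).ofReal_comp).mul_const Complex.I
    simpa using! (h1.add h2).cexp
  have ht : tFun γ = descentPath γ ∘ ψ := by
    ext w
    rw [Function.comp_apply, ← tFun_signedU hγ (hψ w), hψu]
  rw [ht]
  refine (hX.scomp 0 hψd).congr_deriv ?_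
  rw [Complex.real_smul]
  push_cast
  ring

/-- What matters later is the sign, that of `θ - γ`. -/
lemma cEven_zero {Ω γ : ℝ} (hγ : 0 < γ) (b : ErrorType) :
    cEven Ω γ b 0 = Real.exp γ / √(Real.cosh γ) / (Real.exp (theta Ω γ b) - Real.exp γ) := by
  have h : taylorCoeff Ω γ b (2 * 0) =
      ((Real.exp γ / √(Real.cosh γ) / (Real.exp (theta Ω γ b) - Real.exp γ) : ℝ) : ℂ) := by
    rw [taylorCoeff, mul_zero, iteratedDeriv_zero, fFun, (hasDerivAt_tFun_zero hγ).deriv, tFun,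
      if_pos rfl]
    have := Complex.I_ne_zero
    simp only [Nat.factorial_zero, Nat.cast_one, div_one]
    push_cast
    field_simp
  rw [cEven, h, Complex.ofReal_re]

/-! ### Primitives on the upper half-plane -/

/-- The Cayley transform carries the half-plane to the unit disc, where holomorphic functions have
primitives; the derivative of the inverse map is absorbed into the integrand. -/
lemma exists_primitive_upperHalfPlane {f : ℂ → ℂ} (hf : DifferentiableOn ℂ f {z | 0 < z.im}) :
    ∃ g : ℂ → ℂ, ∀ z, 0 < z.im → HasDerivAt g (f z) z := by
  -- `c` is the Cayley transform, `m` its inverse and `m'` the derivative of `m`.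
  let m : ℂ → ℂ := fun w => Complex.I * (1 + w) / (1 - w)
  let m' : ℂ → ℂ := fun w => 2 * Complex.I / (1 - w) ^ 2
  let c : ℂ → ℂ := fun z => (z - Complex.I) / (z + Complex.I)
  have hball : ∀ w ∈ Metric.ball (0 : ℂ) 1, 1 - w ≠ 0 := by
    intro w hw h
    rw [mem_ball_zero_iff, ← sub_eq_zero.1 h, norm_one] at hw
    exact lt_irrefl _ hw
  have hm : ∀ w ∈ Metric.ball (0 : ℂ) 1, HasDerivAt m (m' w) w := by
    intro w hw
    have h1 : HasDerivAt (fun w : ℂ => Complex.I * (1 + w)) Complex.I w := by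
      simpa using ((hasDerivAt_id w).const_add 1).const_mul Complex.I
    have h2 : HasDerivAt (fun w : ℂ => 1 - w) (-1) w := by
      simpa using (hasDerivAt_id w).const_sub 1
    refine (h1.div h2 (hball w hw)).congr_deriv ?_
    simp only [m']
    congr 1
    ring
  have hmim : ∀ w ∈ Metric.ball (0 : ℂ) 1, 0 < (m w).im := by
    intro w hw
    have h0 := hball w hw
    have h1 : (m w).im = (1 - Complex.normSq w) / Complex.normSq (1 - w) := by
      simp only [m, Complex.div_im, Complex.normSq_apply]
      simp
      ring
    rw [h1]
    refine div_pos ?_ (Complex.normSq_pos.2 h0)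
    rw [mem_ball_zero_iff] at hw
    rw [Complex.normSq_eq_norm_sq]
    nlinarith [norm_nonneg w]
  have hG : DifferentiableOn ℂ (fun w => f (m w) * m' w) (Metric.ball 0 1) := by
    refine DifferentiableOn.mul ?_ ?_
    · exact hf.comp (fun w hw => (hm w hw).differentiableAt.differentiableWithinAt)
        (fun w hw => hmim w hw)
    · intro w hw
      have : (1 - w) ^ 2 ≠ 0 := pow_ne_zero _ (hball w hw)
      have h2 : DifferentiableAt ℂ (fun w : ℂ => (1 - w) ^ 2) w := by fun_prop
      exact ((differentiableAt_const _).div h2 this).differentiableWithinAt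
  obtain ⟨H, hH⟩ := hG.isExactOn_ball
  have hz1 : ∀ z : ℂ, 0 < z.im → z + Complex.I ≠ 0 := by
    intro z hz h
    have := congrArg Complex.im h
    simp at this
    linarith
  have hc : ∀ z : ℂ, 0 < z.im → HasDerivAt c (2 * Complex.I / (z + Complex.I) ^ 2) z := by
    intro z hz
    refine (((hasDerivAt_id z).sub_const Complex.I).div ((hasDerivAt_id z).add_const Complex.I)
      (hz1 z hz)).congr_deriv ?_
    simp only [id]
    congr 1
    ring
  have hcm : ∀ z : ℂ, 0 < z.im → c z ∈ Metric.ball (0 : ℂ) 1 := by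
    intro z hz
    rw [mem_ball_zero_iff, norm_div, div_lt_one (norm_pos_iff.2 (hz1 z hz))]
    rw [← sq_lt_sq₀ (norm_nonneg _) (norm_nonneg _), ← Complex.normSq_eq_norm_sq,
      ← Complex.normSq_eq_norm_sq, Complex.normSq_apply, Complex.normSq_apply]
    simp
    nlinarith
  refine ⟨H ∘ c, fun z hz => ?_⟩
  refine ((hH _ (hcm z hz)).comp z (hc z hz)).congr_deriv ?_
  have h1 := hz1 z hz
  have h2 : 1 - c z = 2 * Complex.I / (z + Complex.I) := by
    simp only [c]
    field_simp
    ring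
  have hI := Complex.I_ne_zero
  have h3 : m (c z) = z := by
    simp only [m]
    rw [h2]
    simp only [c]
    field_simp
    ring
  beta_reduce
  rw [h3]
  simp only [m']
  rw [h2]
  field_simp

/-! ### Shifting the contour -/

/-- The integrand `exp (-a α(ln x)) / (e^θ - x)` of the contour integrals. -/
noncomputable def kernel (a γ θ : ℝ) (x : ℂ) : ℂ :=
  Complex.exp (-(a : ℂ) * alphaC γ (Complex.log x)) / ((Real.exp θ : ℂ) - x)

lemma differentiableAt_kernel (a γ θ : ℝ) {x : ℂ} (hx : x ∈ Complex.slitPlane)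
    (h : (Real.exp θ : ℂ) ≠ x) : DifferentiableAt ℂ (kernel a γ θ) x := by
  unfold kernel alphaC
  have h1 : DifferentiableAt ℂ Complex.log x := Complex.differentiableAt_log hx
  have h2 : (Real.exp θ : ℂ) - x ≠ 0 := sub_ne_zero.2 h
  refine DifferentiableAt.div ?_ (by fun_prop) h2
  fun_prop

lemma norm_exp_alphaC_log (a γ : ℝ) {x : ℂ} (hx : x ≠ 0) :
    ‖Complex.exp (-(a : ℂ) * alphaC γ (Complex.log x))‖ =
      Real.exp (-a * (Real.cosh γ - (x.re + (x⁻¹).re) / 2 +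
        Real.sinh γ * (Real.log ‖x‖ - γ))) := by
  have h1 : Complex.cosh (Complex.log x) = (x + x⁻¹) / 2 := by
    rw [Complex.cosh, Complex.exp_neg, Complex.exp_log hx]
  rw [Complex.norm_exp, alphaC, h1, ← Complex.ofReal_neg, Complex.re_ofReal_mul, Complex.add_re,
    Complex.sub_re, Complex.re_ofReal_mul, Complex.sub_re, Complex.log_re, Complex.ofReal_re,
    Complex.ofReal_re, Complex.div_ofNat_re, Complex.add_re]

/-- With `cosh(ln x) = (x + 1/x)/2`, the bounds `Re x ≤ e^γ` and `Re(1/x) ≤ 1` control the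
hyperbolic cosine, and the logarithmic term of `α` supplies the power decay. -/
lemma norm_exp_alphaC_log_le {a γ : ℝ} (ha : 0 < a) {x : ℂ} (hx : 1 ≤ ‖x‖)
    (hre : x.re ≤ Real.exp γ) :
    ‖Complex.exp (-(a : ℂ) * alphaC γ (Complex.log x))‖ ≤
      Real.exp (a * ((Real.exp γ + 1) / 2 - Real.cosh γ + Real.sinh γ * γ)) *
        ‖x‖ ^ (-(a * Real.sinh γ)) := by
  have hpos : 0 < ‖x‖ := by linarith
  rw [norm_exp_alphaC_log _ _ (norm_pos_iff.1 hpos), Real.rpow_def_of_pos hpos, ← Real.exp_add,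
    Real.exp_le_exp]
  have h1 : (x⁻¹).re ≤ 1 := (Complex.re_le_norm _).trans (by
    rw [norm_inv]; exact inv_le_one_of_one_le₀ hx)
  have : 0 ≤ a * ((Real.exp γ - x.re) + (1 - (x⁻¹).re)) := mul_nonneg ha.le (by linarith)
  linarith

/-- Far from the pole the denominator contributes another `1/N`. The total order `N^{-a sinh γ - 1}`
beats arcs of length `O(N)` and makes the line integral converge absolutely. -/
lemma norm_kernel_le {a γ θ : ℝ} (ha : 0 < a) (hγ : 0 < γ) {x : ℂ} {N : ℝ} (hN : 1 ≤ N)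
    (hNθ : 2 * Real.exp θ ≤ N) (hx : N ≤ ‖x‖) (hre : x.re ≤ Real.exp γ) :
    ‖kernel a γ θ x‖ ≤
      Real.exp (a * ((Real.exp γ + 1) / 2 - Real.cosh γ + Real.sinh γ * γ)) *
        N ^ (-(a * Real.sinh γ)) / (N / 2) := by
  have hs := Real.sinh_pos_iff.2 hγ
  rw [kernel, norm_div]
  have h1 : N / 2 ≤ ‖(Real.exp θ : ℂ) - x‖ := by
    have := norm_sub_norm_le x (Real.exp θ : ℂ)
    rw [norm_sub_rev, Complex.norm_real, Real.norm_eq_abs, abs_of_pos (Real.exp_pos _)] at this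
    linarith
  refine div_le_div₀ (by positivity) ?_ (by linarith) h1
  refine (norm_exp_alphaC_log_le ha (hN.trans hx) hre).trans ?_
  exact mul_le_mul_of_nonneg_left (Real.rpow_le_rpow_of_nonpos (zero_lt_one.trans_le hN) hx
    (neg_nonpos.2 (mul_pos ha hs).le)) (Real.exp_pos _).le

lemma hasDerivAt_descentPath {γ : ℝ} (hγ : 0 < γ) {φ : ℝ} (hφ : φ ∈ Ioo 0 Real.pi) :
    HasDerivAt (descentPath γ) ((rPhi' γ φ + Complex.I) * descentPath γ φ) φ := by
  have h1 := (hasDerivAt_rPhi hγ hφ).ofReal_comp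
  have h2 := ((hasDerivAt_id φ).ofReal_comp).mul_const Complex.I
  refine HasDerivAt.congr_deriv (f := descentPath γ) (h1.add h2).cexp ?_
  simp [descentPath]
  ring

lemma kernel_descentPath_im (a γ θ : ℝ) {φ : ℝ} (hφ : φ ∈ Ioo 0 Real.pi)
    {Ω : ℝ} {b : ErrorType} (hθ : theta Ω γ b = θ) :
    (kernel a γ θ (descentPath γ φ) * ((rPhi' γ φ + Complex.I) * descentPath γ φ)).im =
      Real.exp (-a * hPhi γ φ) * gTilde Ω γ b φ := by
  have hsin : 0 < Real.sin φ := Real.sin_pos_of_pos_of_lt_pi hφ.1 hφ.2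
  set r := rPhi γ φ
  set E := Real.exp (θ - r) with hE
  have hX : descentPath γ φ =
      (Real.exp r : ℂ) * ((Real.cos φ : ℂ) + (Real.sin φ : ℂ) * Complex.I) := by
    rw [descentPath, Complex.exp_add, Complex.exp_mul_I]
    push_cast
    rfl
  have hθE : (Real.exp θ : ℂ) = (Real.exp r : ℂ) * (E : ℂ) := by
    rw [← Complex.ofReal_mul, hE, ← Real.exp_add]
    congr 2; ring
  have hD : E ^ 2 - 2 * Real.cos φ * E + 1 = (E - Real.cos φ) ^ 2 + Real.sin φ ^ 2 := by
    rw [Real.sin_sq]; ring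
  have hDpos : 0 < E ^ 2 - 2 * Real.cos φ * E + 1 := by
    rw [hD]; positivity
  have hr0 : (Real.exp r : ℂ) ≠ 0 := by exact_mod_cast (Real.exp_pos r).ne'
  have hden : (E : ℂ) - (Real.cos φ + Real.sin φ * Complex.I) ≠ 0 := by
    intro h
    have := congrArg Complex.im h
    simp at this
    rw [← Complex.ofReal_sin, Complex.ofReal_re] at this
    exact hsin.ne' this
  -- With `e^θ = e^r E` the modulus `e^r` cancels. Multiplying by the conjugate of `E - e^{iφ}`
  -- leaves the real denominator `E² - 2E cos φ + 1`.
  have key : kernel a γ θ (descentPath γ φ) * ((rPhi' γ φ + Complex.I) * descentPath γ φ) =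
      ((Real.exp (-a * hPhi γ φ) / (E ^ 2 - 2 * Real.cos φ * E + 1) : ℝ) : ℂ) *
      ((rPhi' γ φ + Complex.I) * (((Real.cos φ * E - 1 : ℝ) : ℂ) +
        ((Real.sin φ * E : ℝ) : ℂ) * Complex.I)) := by
    rw [kernel, alphaC_log_descentPath (Ioo_zero_pi_subset hφ), hX, hθE, ← mul_sub]
    have hD0 : ((E ^ 2 - 2 * Real.cos φ * E + 1 : ℝ) : ℂ) ≠ 0 := by exact_mod_cast hDpos.ne'
    have h1 : ((E ^ 2 - 2 * Real.cos φ * E + 1 : ℝ) : ℂ) =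
        ((E : ℂ) - (Real.cos φ + Real.sin φ * Complex.I)) *
        ((E : ℂ) - Real.cos φ + Real.sin φ * Complex.I) := by
      rw [hD]
      push_cast
      linear_combination (Complex.sin φ ^ 2) * Complex.I_sq
    rw [Complex.ofReal_div, Complex.ofReal_exp]
    have h2 : (((Real.cos φ * E - 1 : ℝ) : ℂ) + ((Real.sin φ * E : ℝ) : ℂ) * Complex.I) =
        (Real.cos φ + Real.sin φ * Complex.I) *
        ((E : ℂ) - Real.cos φ + Real.sin φ * Complex.I) := by
      have h3 := Complex.sin_sq_add_cos_sq φ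
      push_cast
      linear_combination h3 - (Complex.sin φ ^ 2) * Complex.I_sq
    rw [h1] at hD0 ⊢
    rw [h2]
    have h4 := right_ne_zero_of_mul hD0
    push_cast
    push_cast at h4 hden hr0
    field_simp
  have hexp2 : Real.exp (2 * (θ - r)) = E ^ 2 := by
    rw [hE, ← Real.exp_nat_mul]; norm_num
  have him : ∀ A B C D : ℝ, ((A : ℂ) * ((B + Complex.I) * ((C : ℂ) + D * Complex.I))).im =
      A * (B * D + C) := by
    intro A B C D
    simp
  rw [key, him, gTilde, hθ, hexp2]
  ring

lemma descentPath_im_pos (γ : ℝ) {φ : ℝ} (hφ : φ ∈ Ioo 0 Real.pi) : 0 < (descentPath γ φ).im := by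
  rw [descentPath_im]
  exact mul_pos (Real.exp_pos _) (Real.sin_pos_of_pos_of_lt_pi hφ.1 hφ.2)

/-- The path equation gives `e^r sin φ = 2φ sinh γ + e^{-r} sin φ`, so the path stays in a
horizontal strip while its real part goes to `-∞`. -/
lemma descentPath_im_le {γ : ℝ} (hγ : 0 < γ) {φ : ℝ} (hφ : φ ∈ Ioo 0 Real.pi) :
    (descentPath γ φ).im ≤ 2 * Real.sinh γ * Real.pi + 1 := by
  have hs := Real.sinh_pos_iff.2 hγ
  have h1 := sinh_rPhi_mul_sin γ (Ioo_zero_pi_subset hφ)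
  have h2 : Real.exp (-rPhi γ φ) ≤ 1 :=
    Real.exp_le_one_iff.2 (by linarith [le_rPhi hγ (Ioo_zero_pi_subset hφ)])
  have h3 := Real.sin_pos_of_pos_of_lt_pi hφ.1 hφ.2
  have h4 : Real.exp (-rPhi γ φ) * Real.sin φ ≤ 1 := by
    nlinarith [Real.sin_le_one φ, Real.exp_pos (-rPhi γ φ)]
  rw [Real.sinh_eq] at h1
  rw [descentPath_im]
  nlinarith [hφ.2]

lemma tendsto_neg_re_descentPath {γ : ℝ} (hγ : 0 < γ) :
    Tendsto (fun φ => -(descentPath γ φ).re) (𝓝[<] Real.pi) atTop := by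
  simp_rw [descentPath_re, ← mul_neg]
  refine Tendsto.atTop_mul_pos one_pos (Real.tendsto_exp_atTop.comp (tendsto_rPhi_pi hγ)) ?_
  have := (Real.continuous_cos.neg.tendsto Real.pi)
  rw [Pi.neg_apply, Real.cos_pi, neg_neg] at this
  exact this.mono_left nhdsWithin_le_nhds

/-- The gap between the two contours is closed through a corner: from the path point up to `-N +
iN`, then across to `e^γ + iN`, with `N = -Re` of the path point. The length is `O(N)`, against the
decay in `norm_kernel_le`. -/
lemma tendsto_primitive_far {a γ θ : ℝ} (ha : 0 < a) (hγ : 0 < γ) {g : ℂ → ℂ}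
    (hg : ∀ z, 0 < z.im → HasDerivAt g (kernel a γ θ z) z) :
    Tendsto (fun φ => g (descentPath γ φ) -
      g (Real.exp γ + ((-(descentPath γ φ).re : ℝ) : ℂ) * Complex.I)) (𝓝[<] Real.pi) (𝓝 0) := by
  have hs := Real.sinh_pos_iff.2 hγ
  set D := Real.exp (a * ((Real.exp γ + 1) / 2 - Real.cosh γ + Real.sinh γ * γ))
  set M := 2 * D * (Real.exp γ + 2 * Real.sinh γ * Real.pi + 3)
  have hlim : Tendsto (fun φ => M * (-(descentPath γ φ).re) ^ (-(a * Real.sinh γ)))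
      (𝓝[<] Real.pi) (𝓝 0) := by
    have := ((tendsto_rpow_neg_atTop (mul_pos ha hs)).comp
      (tendsto_neg_re_descentPath hγ)).const_mul M
    simpa using! this
  refine squeeze_zero_norm' ?_ hlim
  filter_upwards [(tendsto_neg_re_descentPath hγ).eventually_ge_atTop (max 1 (2 * Real.exp θ)),
    Ioo_mem_nhdsLT Real.pi_pos] with φ hN hφ
  set c := descentPath γ φ
  set N := -c.re
  have hN1 : 1 ≤ N := (le_max_left _ _).trans hN
  have hNθ : 2 * Real.exp θ ≤ N := (le_max_right _ _).trans hN
  have hN0 : 0 < N := by linarith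
  have hc1 : 0 < c.im := descentPath_im_pos γ hφ
  have hc2 := descentPath_im_le hγ hφ
  set K := D * N ^ (-(a * Real.sinh γ)) / (N / 2)
  have hK : 0 ≤ K := by positivity
  let p : ℂ := (Real.exp γ : ℂ) + (N : ℂ) * Complex.I
  let q : ℂ := ((-N : ℝ) : ℂ) + (N : ℂ) * Complex.I
  have hpre : p.re = Real.exp γ := by simp [p, -Complex.ofReal_exp]
  have hpim : p.im = N := by simp [p, -Complex.ofReal_exp]
  have hqre : q.re = -N := by simp [q]
  have hqim : q.im = N := by simp [q]
  have h1 : ‖g q - g p‖ ≤ K * ‖q - p‖ := by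
    have hconv : Convex ℝ {x : ℂ | x.re ≤ Real.exp γ ∧ N ≤ x.im} :=
      (convex_halfSpace_re_le _).inter (convex_halfSpace_im_ge _)
    refine hconv.norm_image_sub_le_of_norm_hasDerivWithin_le
      (f' := kernel a γ θ) (fun x hx => (hg x (hN0.trans_le hx.2)).hasDerivWithinAt) ?_ ?_ ?_
    · intro x hx
      exact norm_kernel_le ha hγ hN1 hNθ
        (hx.2.trans ((le_abs_self _).trans (Complex.abs_im_le_norm x))) hx.1
    · exact ⟨hpre.le, hpim.ge⟩
    · exact ⟨by rw [hqre]; linarith [Real.exp_pos γ], hqim.ge⟩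
  have h2 : ‖g c - g q‖ ≤ K * ‖c - q‖ := by
    have hconv : Convex ℝ {x : ℂ | x.re ≤ -N ∧ 0 < x.im} :=
      (convex_halfSpace_re_le _).inter (convex_halfSpace_im_gt _)
    refine hconv.norm_image_sub_le_of_norm_hasDerivWithin_le
      (f' := kernel a γ θ) (fun x hx => (hg x hx.2).hasDerivWithinAt) ?_ ?_ ?_
    · intro x hx
      refine norm_kernel_le ha hγ hN1 hNθ ?_ ?_
      · have h3 := Complex.abs_re_le_norm x
        have h4 := neg_abs_le x.re
        linarith [hx.1]
      · linarith [hx.1, Real.exp_pos γ]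
    · exact ⟨hqre.le, by rw [hqim]; exact hN0⟩
    · exact ⟨by simp [N], hc1⟩
  have h3 : ‖q - p‖ ≤ N + Real.exp γ := by
    refine (Complex.norm_le_abs_re_add_abs_im _).trans ?_
    rw [Complex.sub_re, Complex.sub_im, hpre, hpim, hqre, hqim, sub_self, abs_zero, add_zero,
      abs_of_nonpos (by linarith [Real.exp_pos γ])]
    linarith
  have h4 : ‖c - q‖ ≤ N + (2 * Real.sinh γ * Real.pi + 1) := by
    refine (Complex.norm_le_abs_re_add_abs_im _).trans ?_
    rw [Complex.sub_re, Complex.sub_im, hqre, hqim, sub_neg_eq_add, show c.re + N = 0 by simp [N],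
      abs_zero, zero_add, abs_le]
    constructor <;> linarith [mul_pos (mul_pos two_pos hs) Real.pi_pos]
  calc ‖g c - g p‖ = ‖(g c - g q) + (g q - g p)‖ := by congr 1; ring
    _ ≤ K * (N + (2 * Real.sinh γ * Real.pi + 1)) + K * (N + Real.exp γ) := by
      refine (norm_add_le _ _).trans (add_le_add (h2.trans ?_) (h1.trans ?_)) <;> gcongr
    _ = 2 * D * N ^ (-(a * Real.sinh γ)) *
        ((Real.exp γ + 2 * Real.sinh γ * Real.pi + 1) / N + 2) := by
      simp only [K]; field_simp; ring
    _ ≤ 2 * D * N ^ (-(a * Real.sinh γ)) *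
        ((Real.exp γ + 2 * Real.sinh γ * Real.pi + 1) + 2) := by
      gcongr
      exact div_le_self (by positivity) hN1
    _ = M * N ^ (-(a * Real.sinh γ)) := by simp only [M]; ring

/-- The primitive lives on the open half-plane only, so the common starting point `e^γ` is reached
as a limit. As `e^γ` is not the pole, the kernel is bounded near it and the mean value inequality
applies. -/
lemma tendsto_primitive_near {a γ θ : ℝ} (hθ : γ ≠ θ) {g : ℂ → ℂ}
    (hg : ∀ z, 0 < z.im → HasDerivAt g (kernel a γ θ z) z) :
    Tendsto (fun ε : ℝ => g (descentPath γ ε) - g (Real.exp γ + (ε : ℂ) * Complex.I))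
      (𝓝[>] 0) (𝓝 0) := by
  have hne : (Real.exp θ : ℂ) ≠ (Real.exp γ : ℂ) := by
    intro h
    exact hθ (Real.exp_injective (by exact_mod_cast h.symm))
  have hsl : (Real.exp γ : ℂ) ∈ Complex.slitPlane :=
    Complex.ofReal_mem_slitPlane.2 (Real.exp_pos γ)
  have hc := (differentiableAt_kernel a γ θ hsl hne).continuousAt.norm
  have hb : ∀ᶠ x in 𝓝 (Real.exp γ : ℂ), ‖kernel a γ θ x‖ < ‖kernel a γ θ (Real.exp γ)‖ + 1 :=
    hc.eventually (gt_mem_nhds (lt_add_one _))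
  obtain ⟨δ, hδ, hball⟩ := Metric.eventually_nhds_iff_ball.1 hb
  set K := ‖kernel a γ θ (Real.exp γ)‖ + 1
  have hX : Tendsto (descentPath γ) (𝓝[>] 0) (𝓝 (Real.exp γ : ℂ)) := by
    have h : ContinuousAt (descentPath γ) 0 := by
      have h1 := Complex.continuous_ofReal.continuousAt.comp (hasDerivAt_rPhi_zero γ).continuousAt
      have h2 : ContinuousAt (fun φ : ℝ => (φ : ℂ) * Complex.I) 0 := by fun_prop
      exact Complex.continuous_exp.continuousAt.comp (f := fun φ : ℝ =>
        ((rPhi γ φ : ℝ) : ℂ) + (φ : ℂ) * Complex.I) (h1.add h2)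
    have h3 := h.tendsto
    simp only [descentPath, rPhi_zero, Complex.ofReal_zero, zero_mul, add_zero] at h3
    rw [Complex.ofReal_exp]
    exact h3.mono_left nhdsWithin_le_nhds
  have hY : Tendsto (fun ε : ℝ => (Real.exp γ : ℂ) + (ε : ℂ) * Complex.I) (𝓝[>] 0)
      (𝓝 (Real.exp γ : ℂ)) := by
    have h : Continuous (fun ε : ℝ => (Real.exp γ : ℂ) + (ε : ℂ) * Complex.I) := by fun_prop
    have h3 := h.tendsto 0
    simp only [Complex.ofReal_zero, zero_mul, add_zero] at h3
    exact h3.mono_left nhdsWithin_le_nhds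
  have hlim : Tendsto (fun ε : ℝ => K * ‖descentPath γ ε -
      ((Real.exp γ : ℂ) + (ε : ℂ) * Complex.I)‖) (𝓝[>] 0) (𝓝 0) := by
    simpa using (hX.sub hY).norm.const_mul K
  refine squeeze_zero_norm' ?_ hlim
  filter_upwards [hX.eventually (Metric.ball_mem_nhds _ hδ),
    hY.eventually (Metric.ball_mem_nhds _ hδ), Ioo_mem_nhdsGT Real.pi_pos] with ε h1 h2 hε
  have hconv : Convex ℝ (Metric.ball (Real.exp γ : ℂ) δ ∩ {x : ℂ | 0 < x.im}) :=
    (convex_ball _ _).inter (convex_halfSpace_im_gt _)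
  refine hconv.norm_image_sub_le_of_norm_hasDerivWithin_le
      (f' := kernel a γ θ) (fun x hx => (hg x hx.2).hasDerivWithinAt)
      (fun x hx => (hball x hx.1).le) ⟨h2, ?_⟩ ⟨h1, descentPath_im_pos γ hε⟩
  simpa [← Complex.ofReal_exp] using hε.1

lemma hasDerivAt_im_comp {g : ℂ → ℂ} {p : ℝ → ℂ} {g' p' : ℂ} {x : ℝ} (hg : HasDerivAt g g' (p x))
    (hp : HasDerivAt p p' x) : HasDerivAt (fun y => (g (p y)).im) (g' * p').im x := by
  have h := hg.comp x hp
  exact (Complex.imCLM.hasFDerivAt.comp_hasDerivAt x h)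

/-- The base point `0` need not lie in `s`: integrability reaches the endpoint although the
primitive may not. -/
lemma sub_primitive_eq {f F : ℝ → ℝ} {s : Set ℝ} (hs : s.OrdConnected) {x y : ℝ}
    (hx : x ∈ s) (hy : y ∈ s)
    (hF : ∀ z ∈ s, HasDerivAt F (f z) z)
    (hi : ∀ z ∈ s, IntervalIntegrable f volume 0 z) :
    (∫ z in (0 : ℝ)..x, f z) - F x = (∫ z in (0 : ℝ)..y, f z) - F y := by
  have h := intervalIntegral.integral_eq_sub_of_hasDerivAt
    (fun z hz => hF z (hs.uIcc_subset hx hy hz)) ((hi x hx).symm.trans (hi y hy))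
  rw [← intervalIntegral.integral_interval_sub_left (hi y hy) (hi x hx)] at h
  linarith

/-- The vertical line through the saddle point may be deformed into the path of steepest
descent. -/
theorem integral_kernel_line_eq {a γ θ Ω : ℝ} {b : ErrorType} (ha : 0 < a) (hγ : 0 < γ)
    (hθ : γ ≠ θ) (hθb : theta Ω γ b = θ)
    (hcurve : IntegrableOn (fun φ => Real.exp (-a * hPhi γ φ) * gTilde Ω γ b φ) (Ioo 0 Real.pi))
    (hline : IntegrableOn (fun y : ℝ => (kernel a γ θ (Real.exp γ + y * Complex.I)).re) (Ioi 0)) :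
    ∫ y in Ioi (0 : ℝ), (kernel a γ θ (Real.exp γ + y * Complex.I)).re =
      ∫ φ in Ioo 0 Real.pi, Real.exp (-a * hPhi γ φ) * gTilde Ω γ b φ := by
  obtain ⟨g, hg⟩ := exists_primitive_upperHalfPlane (f := kernel a γ θ) (fun z hz =>
    (differentiableAt_kernel a γ θ (Complex.mem_slitPlane_iff.2 (Or.inr (ne_of_gt hz))) (by
      rintro h
      have hz : 0 < z.im := hz
      rw [← h, Complex.ofReal_im] at hz
      exact lt_irrefl _ hz)).differentiableWithinAt)
  set fc := fun φ => Real.exp (-a * hPhi γ φ) * gTilde Ω γ b φ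
  set fl := fun y : ℝ => (kernel a γ θ (Real.exp γ + y * Complex.I)).re
  set Ac := fun φ => (g (descentPath γ φ)).im
  set Al := fun y : ℝ => (g (Real.exp γ + y * Complex.I)).im
  have hAc : ∀ φ ∈ Ioo 0 Real.pi, HasDerivAt Ac (fc φ) φ := by
    intro φ hφ
    have h := hasDerivAt_im_comp (hg _ (descentPath_im_pos γ hφ)) (hasDerivAt_descentPath hγ hφ)
    rwa [kernel_descentPath_im a γ θ hφ hθb] at h
  have hAl : ∀ y ∈ Ioi (0 : ℝ), HasDerivAt Al (fl y) y := by
    intro y hy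
    have hp : HasDerivAt (fun y : ℝ => (Real.exp γ : ℂ) + y * Complex.I) Complex.I y := by
      simpa using! (((hasDerivAt_id y).ofReal_comp).mul_const Complex.I).const_add (Real.exp γ : ℂ)
    have h := hasDerivAt_im_comp (p := fun y : ℝ => (Real.exp γ : ℂ) + y * Complex.I)
      (hg _ (by simpa [← Complex.ofReal_exp] using hy)) hp
    -- On the line `dx = i dy`, so the imaginary part of the integral is the integral of the real
    -- part of the kernel.
    rwa [Complex.mul_I_im] at h
  have hic : ∀ φ ∈ Icc 0 Real.pi, IntervalIntegrable fc volume 0 φ := by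
    intro φ hφ
    rw [intervalIntegrable_iff_integrableOn_Ioo_of_le hφ.1]
    exact hcurve.mono_set (Ioo_subset_Ioo_right hφ.2)
  have hil : ∀ y ∈ Ici (0 : ℝ), IntervalIntegrable fl volume 0 y := by
    intro y hy
    rw [intervalIntegrable_iff_integrableOn_Ioo_of_le hy]
    exact hline.mono_set Ioo_subset_Ioi_self
  set Pc := fun φ => ∫ z in (0 : ℝ)..φ, fc z
  set Pl := fun y => ∫ z in (0 : ℝ)..y, fl z
  have hPc : ContinuousOn Pc (uIcc 0 Real.pi) :=
    intervalIntegral.continuousOn_primitive_interval' (hic _ ⟨Real.pi_pos.le, le_rfl⟩)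
      left_mem_uIcc
  have hPl : ContinuousOn Pl (uIcc 0 1) :=
    intervalIntegral.continuousOn_primitive_interval' (hil _ (show (0 : ℝ) ≤ 1 by norm_num))
      left_mem_uIcc
  rw [uIcc_of_le Real.pi_pos.le] at hPc
  rw [uIcc_of_le zero_le_one] at hPl
  have hc0 : Tendsto Pc (𝓝[>] 0) (𝓝 0) := by
    have h := (hPc 0 ⟨le_rfl, Real.pi_pos.le⟩).tendsto
    simp only [Pc, intervalIntegral.integral_same] at h
    exact h.mono_left (nhdsWithin_le_of_mem (mem_of_superset (Ioo_mem_nhdsGT Real.pi_pos)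
      Ioo_subset_Icc_self))
  have hl0 : Tendsto Pl (𝓝[>] 0) (𝓝 0) := by
    have h := (hPl 0 ⟨le_rfl, zero_le_one⟩).tendsto
    simp only [Pl, intervalIntegral.integral_same] at h
    exact h.mono_left (nhdsWithin_le_of_mem (mem_of_superset (Ioo_mem_nhdsGT one_pos)
      Ioo_subset_Icc_self))
  have hcpi : Tendsto Pc (𝓝[<] Real.pi) (𝓝 (Pc Real.pi)) :=
    ((hPc _ ⟨Real.pi_pos.le, le_rfl⟩).tendsto).mono_left
      (nhdsWithin_le_of_mem (mem_of_superset (Ioo_mem_nhdsLT Real.pi_pos) Ioo_subset_Icc_self))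
  have hlinf : Tendsto (fun φ => Pl (-(descentPath γ φ).re)) (𝓝[<] Real.pi)
      (𝓝 (∫ y in Ioi 0, fl y)) :=
    intervalIntegral_tendsto_integral_Ioi 0 hline (tendsto_neg_re_descentPath hγ)
  have hfar : Tendsto (fun φ => Ac φ - Al (-(descentPath γ φ).re)) (𝓝[<] Real.pi) (𝓝 0) :=
    (Complex.continuous_im.tendsto _).comp (tendsto_primitive_far ha hγ hg)
  have hnear : Tendsto (fun ε => Ac ε - Al ε) (𝓝[>] 0) (𝓝 0) :=
    (Complex.continuous_im.tendsto _).comp (tendsto_primitive_near hθ hg)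
  -- On each contour the integral from the start differs from `Im g` by a constant. The limit at the
  -- saddle shows that the constants `Kc` and `Kl` agree; the limit at infinity then equates the
  -- full integrals.
  have hmid : Real.pi / 2 ∈ Ioo 0 Real.pi := ⟨by positivity, by linarith [Real.pi_pos]⟩
  set Kc := Pc (Real.pi / 2) - Ac (Real.pi / 2)
  set Kl := Pl 1 - Al 1
  have hKc : ∀ φ ∈ Ioo 0 Real.pi, Pc φ - Ac φ = Kc := fun φ hφ =>
    sub_primitive_eq ordConnected_Ioo hφ hmid hAc (fun z hz => hic z (Ioo_subset_Icc_self hz))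
  have hKl : ∀ y ∈ Ioi (0 : ℝ), Pl y - Al y = Kl := fun y hy =>
    sub_primitive_eq ordConnected_Ioi hy (mem_Ioi.2 one_pos) hAl (fun z hz => hil z (Ioi_subset_Ici_self hz))
  have hK0 : Kc - Kl = 0 := by
    have h1 : Tendsto (fun ε => Pc ε - Pl ε - (Ac ε - Al ε)) (𝓝[>] 0) (𝓝 (0 - 0 - 0)) :=
      (hc0.sub hl0).sub hnear
    rw [sub_zero, sub_zero] at h1
    refine tendsto_nhds_unique (tendsto_const_nhds.congr' ?_) h1
    filter_upwards [Ioo_mem_nhdsGT Real.pi_pos] with ε hε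
    linarith [hKc ε hε, hKl ε hε.1]
  have hfin : Kc - Kl = Pc Real.pi - (∫ y in Ioi 0, fl y) - 0 := by
    refine tendsto_nhds_unique (tendsto_const_nhds.congr' ?_) ((hcpi.sub hlinf).sub hfar)
    filter_upwards [Ioo_mem_nhdsLT Real.pi_pos,
      (tendsto_neg_re_descentPath hγ).eventually_gt_atTop 0] with φ hφ hN
    linarith [hKc φ hφ, hKl _ hN]
  have hPpi : Pc Real.pi = ∫ φ in Ioo 0 Real.pi, fc φ := by
    simp only [Pc]
    rw [intervalIntegral.integral_of_le Real.pi_pos.le, integral_Ioc_eq_integral_Ioo]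
  rw [← hPpi]
  linarith

/-! ### Integrability along the two contours -/

/-- This form stays continuous at `φ = π`, where `r` tends to infinity and `sinc` vanishes. -/
lemma exp_sub_rPhi {γ θ : ℝ} {φ : ℝ} (hφ : φ ∈ Ioo (-Real.pi) Real.pi) :
    Real.exp (θ - rPhi γ φ) = Real.exp θ * Real.sinc φ /
      (Real.sinh γ + √(Real.sinc φ ^ 2 + Real.sinh γ ^ 2)) := by
  have hS := sinc_pos hφ
  have h1 : √(1 + (Real.sinh γ / Real.sinc φ) ^ 2) =
      √(Real.sinc φ ^ 2 + Real.sinh γ ^ 2) / Real.sinc φ := by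
    rw [eq_div_iff hS.ne']
    nth_rewrite 2 [← Real.sqrt_sq hS.le]
    rw [← Real.sqrt_mul (by positivity)]
    congr 1
    field_simp
  rw [Real.exp_sub, rPhi, Real.exp_arsinh, h1, ← add_div, div_div_eq_mul_div]

lemma rPhi'_mul_sin {γ φ : ℝ} (hφ : φ ∈ Ioo 0 Real.pi) : rPhi' γ φ * Real.sin φ =
    (Real.sinc φ - Real.cos φ) / √(1 + Real.sinc φ ^ 2 / Real.sinh γ ^ 2) := by
  have hsin : Real.sin φ ≠ 0 := (Real.sin_pos_of_pos_of_lt_pi hφ.1 hφ.2).ne'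
  have h0 : φ ≠ 0 := hφ.1.ne'
  rw [rPhi', div_mul_eq_mul_div, Real.sinc_of_ne_zero h0, Real.cot_eq_cos_div_sin]
  congr 1
  field_simp

lemma continuousOn_hPhi (γ : ℝ) : ContinuousOn (hPhi γ) (Ioo 0 Real.pi) := fun _ hx =>
  (continuousAt_hPhi γ (Ioo_zero_pi_subset hx)).continuousWithinAt

/-- `g̃` extends continuously to `[0, π]`. Its denominator is `(E - cos φ)² + sin² φ`, which could
vanish only at `φ = 0` with `E = 1`, that is `θ = γ`, or at `φ = π`, where `E = 0 ≠ -1`. -/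
lemma integrableOn_gTilde {a γ Ω : ℝ} {b : ErrorType} (ha : 0 ≤ a) (hγ : 0 < γ)
    (hθ : γ ≠ theta Ω γ b) :
    IntegrableOn (fun φ => Real.exp (-a * hPhi γ φ) * gTilde Ω γ b φ) (Ioo 0 Real.pi) := by
  set θ := theta Ω γ b
  have hs := Real.sinh_pos_iff.2 hγ
  let E : ℝ → ℝ := fun φ => Real.exp θ * Real.sinc φ /
      (Real.sinh γ + √(Real.sinc φ ^ 2 + Real.sinh γ ^ 2))
  have hE : Continuous E := by
    refine Continuous.div ?_ ?_ (fun φ => ?_)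
    · exact continuous_const.mul Real.continuous_sinc
    · exact continuous_const.add ((Real.continuous_sinc.pow 2).add continuous_const).sqrt
    · have := Real.sqrt_nonneg (Real.sinc φ ^ 2 + Real.sinh γ ^ 2)
      positivity
  have hEr : ∀ φ ∈ Ioo (-Real.pi) Real.pi, E φ = Real.exp (θ - rPhi γ φ) := fun φ hφ =>
    (exp_sub_rPhi hφ).symm
  let G : ℝ → ℝ := fun φ => (E φ * (Real.cos φ +
      (Real.sinc φ - Real.cos φ) / √(1 + Real.sinc φ ^ 2 / Real.sinh γ ^ 2)) - 1) /
      (E φ ^ 2 - 2 * Real.cos φ * E φ + 1)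
  have hden : ∀ φ ∈ Icc 0 Real.pi, E φ ^ 2 - 2 * Real.cos φ * E φ + 1 ≠ 0 := by
    intro φ hφ h
    have h1 : (E φ - Real.cos φ) ^ 2 + Real.sin φ ^ 2 = 0 := by
      rw [Real.sin_sq]; linarith
    have h2 : Real.sin φ = 0 := by nlinarith [sq_nonneg (E φ - Real.cos φ), sq_nonneg (Real.sin φ)]
    have h3 : E φ = Real.cos φ := by
      nlinarith [sq_nonneg (E φ - Real.cos φ), sq_nonneg (Real.sin φ)]
    rcases hφ.1.eq_or_lt with rfl | h4
    · rw [hEr 0 ⟨by linarith [Real.pi_pos], Real.pi_pos⟩, rPhi_zero, Real.cos_zero,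
        Real.exp_eq_one_iff] at h3
      exact hθ (by linarith)
    · rcases hφ.2.eq_or_lt with rfl | h5
      · have : E Real.pi = 0 := by
          simp [E, Real.sinc_of_ne_zero Real.pi_pos.ne']
        rw [this, Real.cos_pi] at h3
        norm_num at h3
      · exact (Real.sin_pos_of_pos_of_lt_pi h4 h5).ne' h2
  have hGc : ContinuousOn G (Icc 0 Real.pi) := by
    refine ContinuousOn.div (Continuous.continuousOn ?_) (Continuous.continuousOn ?_) hden
    · refine (hE.mul (Real.continuous_cos.add (Continuous.div ?_ ?_ ?_))).sub continuous_const
      · exact Real.continuous_sinc.sub Real.continuous_cos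
      · exact (continuous_const.add ((Real.continuous_sinc.pow 2).div_const _)).sqrt
      · intro φ
        exact (Real.sqrt_pos.2 (by positivity)).ne'
    · exact ((hE.pow 2).sub ((continuous_const.mul Real.continuous_cos).mul hE)).add
        continuous_const
  have hGi : IntegrableOn G (Ioo 0 Real.pi) :=
    hGc.integrableOn_Icc.mono_set Ioo_subset_Icc_self
  have hprod : IntegrableOn (fun φ => Real.exp (-a * hPhi γ φ) * G φ) (Ioo 0 Real.pi) := by
    refine Integrable.bdd_mul (c := 1) hGi ?_ ?_
    · refine ContinuousOn.aestronglyMeasurable ?_ measurableSet_Ioo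
      exact Real.continuous_exp.comp_continuousOn (continuousOn_const.mul (continuousOn_hPhi γ))
    · refine (ae_restrict_iff' measurableSet_Ioo).2 (Eventually.of_forall fun φ hφ => ?_)
      rw [Real.norm_eq_abs, abs_of_pos (Real.exp_pos _), Real.exp_le_one_iff]
      have := hPhi_pos hγ hφ
      nlinarith
  refine hprod.congr_fun (fun φ hφ => ?_) measurableSet_Ioo
  have h2 : Real.exp (2 * (θ - rPhi γ φ)) = Real.exp (θ - rPhi γ φ) ^ 2 := by
    rw [← Real.exp_nat_mul]; norm_num
  simp only [G]
  rw [hEr φ (Ioo_zero_pi_subset hφ), ← rPhi'_mul_sin hφ, gTilde, h2]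

lemma integrable_kernel_line {a γ θ : ℝ} (ha : 0 < a) (hγ : 0 < γ) (hθ : γ ≠ θ) :
    Integrable (fun y : ℝ => kernel a γ θ (Real.exp γ + y * Complex.I)) := by
  have hs := Real.sinh_pos_iff.2 hγ
  have hre : ∀ y : ℝ, ((Real.exp γ : ℂ) + y * Complex.I).re = Real.exp γ := by
    intro y; simp [-Complex.ofReal_exp]
  have him : ∀ y : ℝ, ((Real.exp γ : ℂ) + y * Complex.I).im = y := by
    intro y; simp [-Complex.ofReal_exp]
  have hcont : Continuous (fun y : ℝ => kernel a γ θ (Real.exp γ + y * Complex.I)) := by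
    rw [continuous_iff_continuousAt]
    intro y
    refine ContinuousAt.comp (f := fun y : ℝ => (Real.exp γ : ℂ) + y * Complex.I)
      (differentiableAt_kernel a γ θ ?_ ?_).continuousAt (by fun_prop)
    · exact Complex.mem_slitPlane_iff.2 (Or.inl (by rw [hre]; exact Real.exp_pos _))
    · intro h
      have := congrArg Complex.re h
      rw [hre, Complex.ofReal_re] at this
      exact hθ (Real.exp_injective this.symm)
  set p := a * Real.sinh γ
  have hp : 0 < p := mul_pos ha hs
  set D := Real.exp (a * ((Real.exp γ + 1) / 2 - Real.cosh γ + Real.sinh γ * γ))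
  have hg : Integrable (fun y : ℝ => (1 + ‖y‖ ^ 2) ^ (-(p + 1) / 2)) :=
    integrable_rpow_neg_one_add_norm_sq (by simp [hp])
  refine (hcont.locallyIntegrable).integrable_of_isBigO_cocompact ?_
    (hg.integrableAtFilter _)
  refine Asymptotics.IsBigO.of_bound (2 * D * 2 ^ ((p + 1) / 2)) ?_
  have hcc := (tendsto_norm_cocompact_atTop (E := ℝ)).eventually_ge_atTop
    (max 1 (2 * Real.exp θ))
  filter_upwards [hcc] with y hy
  have hN1 : 1 ≤ ‖y‖ := (le_max_left _ _).trans hy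
  have hN0 : 0 < ‖y‖ := by linarith
  have h1 := norm_kernel_le (x := (Real.exp γ : ℂ) + y * Complex.I) ha hγ hN1
    ((le_max_right _ _).trans hy) (by
      have := Complex.abs_im_le_norm ((Real.exp γ : ℂ) + y * Complex.I)
      rwa [him] at this) (hre y).le
  refine h1.trans ?_
  rw [Real.norm_of_nonneg (Real.rpow_nonneg (by positivity) _)]
  -- For `|y| ≥ 1` one has `1 + y² ≤ 2y²`; this is where the factor `2^((p+1)/2)` comes from.
  have h2 : (2 * ‖y‖ ^ 2) ^ (-(p + 1) / 2) ≤ (1 + ‖y‖ ^ 2) ^ (-(p + 1) / 2) :=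
    Real.rpow_le_rpow_of_nonpos (by positivity) (by nlinarith) (by linarith)
  have h3 : (2 * ‖y‖ ^ 2) ^ (-(p + 1) / 2) = 2 ^ (-(p + 1) / 2) * (‖y‖ ^ (-p) / ‖y‖) := by
    rw [Real.mul_rpow zero_le_two (by positivity), ← Real.rpow_natCast, ← Real.rpow_mul hN0.le,
      ← Real.rpow_sub_one hN0.ne']
    congr 2
    push_cast
    ring
  have h4 : (2 : ℝ) ^ ((p + 1) / 2) * 2 ^ (-(p + 1) / 2) = 1 := by
    rw [← Real.rpow_add two_pos]
    rw [show (p + 1) / 2 + -(p + 1) / 2 = 0 by ring, Real.rpow_zero]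
  calc D * ‖y‖ ^ (-p) / (‖y‖ / 2) = 2 * D * 2 ^ ((p + 1) / 2) *
        (2 ^ (-(p + 1) / 2) * (‖y‖ ^ (-p) / ‖y‖)) := by
        rw [mul_assoc (2 * D), ← mul_assoc ((2 : ℝ) ^ ((p + 1) / 2)), h4]
        field_simp
    _ ≤ _ := by
        rw [← h3]
        gcongr

/-! ### Inversion of the two-sided Laplace transform -/

/-- Fourier inversion for the expectation `E k(t - Q)`, where `k` is bounded and continuous off
the origin. -/
theorem expectation_eq_laplace_inversion {S : Type*} [MeasurableSpace S] {μ : Measure S}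
    [IsProbabilityMeasure μ] {Q : S → ℝ} (hQ : Measurable Q) {k : ℝ → ℝ} (hk : Measurable k)
    (hk1 : ∀ u, |k u| ≤ 1) (hkc : ∀ u, u ≠ 0 → ContinuousAt k u) {c : ℝ}
    (hck : Integrable (fun u => Real.exp (-c * u) * k u))
    (hcQ : Integrable (fun ω => Real.exp (-c * Q ω)) μ) {q : ℝ} (hq : μ {ω | Q ω = q} = 0)
    {Φ : ℝ → ℂ} (hΦ : ∀ ξ : ℝ, (∫ ω, Complex.exp (-(c + 2 * Real.pi * ξ * Complex.I) * Q ω) ∂μ) *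
      (∫ u : ℝ, Complex.exp (-(c + 2 * Real.pi * ξ * Complex.I) * u) * k u) = Φ ξ)
    (hΦi : Integrable Φ) :
    ((∫ ω, k (q - Q ω) ∂μ : ℝ) : ℂ) =
      Complex.exp (c * q) * ∫ ξ : ℝ, Complex.exp (2 * Real.pi * ξ * q * Complex.I) * Φ ξ := by
  set G : ℝ → ℝ := fun t => ∫ ω, k (t - Q ω) ∂μ
  have hmeas : Measurable (fun z : ℝ × S => k (z.1 - Q z.2)) :=
    hk.comp (measurable_fst.sub (hQ.comp measurable_snd))
  have hprod : Integrable (fun z : ℝ × S => Real.exp (-c * z.1) * k (z.1 - Q z.2))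
      (volume.prod μ) := by
    rw [integrable_prod_iff']
    -- Splitting the weight as `e^{-cQ} e^{-c(t-Q)}` separates the variables up to a translation, as
    -- Fubini requires.
    · have hfac : ∀ (t : ℝ) (ω : S), Real.exp (-c * t) * k (t - Q ω) =
          Real.exp (-c * Q ω) * (Real.exp (-c * (t - Q ω)) * k (t - Q ω)) := by
        intro t ω
        rw [← mul_assoc, ← Real.exp_add]
        congr 2
        ring
      refine ⟨Eventually.of_forall fun ω => ?_, ?_⟩
      · simp_rw [hfac]
        exact (hck.comp_sub_right (Q ω)).const_mul _
      · have : ∀ ω, ∫ t, ‖Real.exp (-c * t) * k (t - Q ω)‖ =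
            Real.exp (-c * Q ω) * ∫ u, ‖Real.exp (-c * u) * k u‖ := by
          intro ω
          simp_rw [hfac, norm_mul (Real.exp (-c * Q ω)), integral_const_mul,
            Real.norm_of_nonneg (Real.exp_pos (-c * Q ω)).le]
          congr 1
          exact integral_sub_right_eq_self (fun u => ‖Real.exp (-c * u) * k u‖) (Q ω)
        simp_rw [this]
        exact hcQ.mul_const _
    · exact ((measurable_const.mul measurable_fst).exp.mul hmeas).aestronglyMeasurable
  set g : ℝ → ℂ := fun t => Complex.exp (-c * t) * (G t : ℂ)
  have hgeq : ∀ t, g t = ((∫ ω, Real.exp (-c * t) * k (t - Q ω) ∂μ : ℝ) : ℂ) := by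
    intro t
    rw [integral_const_mul]
    push_cast
    rfl
  have hgi : Integrable g := by
    rw [show g = fun t => ((∫ ω, Real.exp (-c * t) * k (t - Q ω) ∂μ : ℝ) : ℂ) from funext hgeq]
    exact hprod.integral_prod_left.ofReal
  have hGc : ContinuousAt G q := by
    refine continuousAt_of_dominated (bound := fun _ => 1) ?_ ?_ (integrable_const _) ?_
    · exact Eventually.of_forall fun t =>
        (hk.comp (measurable_const.sub hQ)).aestronglyMeasurable
    · exact Eventually.of_forall fun t => Eventually.of_forall fun ω => hk1 _
    -- The only possible jump of `k` is met when `Q = q`, a null event.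
    · have : ∀ᵐ ω ∂μ, Q ω ≠ q := by
        rw [ae_iff]
        simpa using hq
      filter_upwards [this] with ω hω
      exact ContinuousAt.comp (g := k) (f := fun t => t - Q ω)
        (hkc _ (sub_ne_zero.2 hω.symm)) (by fun_prop)
  have hgc : ContinuousAt g q :=
    ContinuousAt.mul (by fun_prop) (Complex.continuous_ofReal.continuousAt.comp hGc)
  have hF : FourierTransform.fourier g = Φ := by
    ext ξ
    rw [Real.fourier_real_eq_integral_exp_smul, ← hΦ]
    set τ : ℂ := c + 2 * Real.pi * ξ * Complex.I
    have h1 : ∀ t : ℝ, Complex.exp (((-2 * Real.pi * t * ξ : ℝ) : ℂ) * Complex.I) • g t =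
        ∫ ω, Complex.exp (-τ * t) * (k (t - Q ω) : ℂ) ∂μ := by
      intro t
      rw [integral_const_mul, integral_complex_ofReal, smul_eq_mul, ← mul_assoc,
        ← Complex.exp_add]
      congr 2
      simp only [τ]
      push_cast
      ring
    simp_rw [h1]
    rw [integral_integral_swap]
    · rw [← integral_mul_const]
      congr 1
      ext ω
      rw [← integral_const_mul,
        ← integral_sub_right_eq_self (fun u : ℝ =>
          Complex.exp (-τ * Q ω) * (Complex.exp (-τ * u) * (k u : ℂ))) (Q ω)]
      congr 1
      ext t
      rw [← mul_assoc, ← Complex.exp_add]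
      congr 2
      push_cast
      ring
    · refine hprod.ofReal (𝕜 := ℂ) |>.mono ?_ ?_
      · refine Measurable.aestronglyMeasurable ?_
        refine Measurable.mul ?_ (Complex.measurable_ofReal.comp hmeas)
        exact Complex.measurable_exp.comp
          (measurable_const.mul (Complex.measurable_ofReal.comp measurable_fst))
      · refine Eventually.of_forall fun z => ?_
        rw [Function.uncurry, norm_mul, Complex.norm_exp]
        simp [τ, Real.norm_eq_abs, Complex.norm_exp]
  have hinv := hgi.fourierInv_fourier_eq (by rw [hF]; exact hΦi) hgc
  rw [hF, Real.fourierInv_eq'] at hinv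
  have h2 : (G q : ℂ) = Complex.exp (c * q) * g q := by
    simp only [g]
    rw [← mul_assoc, ← Complex.exp_add]
    simp
  change (G q : ℂ) = _
  rw [h2, ← hinv]
  congr 2
  ext ξ
  rw [smul_eq_mul]
  congr 2
  simp
  ring

/-! ### The inversion integral in terms of the kernel -/

lemma kernel_conj (a γ θ : ℝ) {x : ℂ} (hx : x ∈ Complex.slitPlane) :
    kernel a γ θ ((starRingEnd ℂ) x) = (starRingEnd ℂ) (kernel a γ θ x) := by
  have h := Complex.log_conj x (Complex.mem_slitPlane_iff_arg.1 hx).1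
  simp only [kernel, alphaC, h, map_div₀, map_sub, map_add, map_mul, map_neg, Complex.conj_ofReal,
    ← Complex.exp_conj, ← Complex.cosh_conj]

lemma integral_re_kernel_line {a γ θ : ℝ} :
    ∫ y : ℝ, (kernel a γ θ (Real.exp γ + y * Complex.I)).re =
      2 * ∫ y in Ioi (0 : ℝ), (kernel a γ θ (Real.exp γ + y * Complex.I)).re := by
  rw [← integral_comp_abs (f := fun y : ℝ => (kernel a γ θ (Real.exp γ + y * Complex.I)).re)]
  congr 1
  ext y
  rcases abs_choice y with h | h
  · rw [h]
  · have hsl : (Real.exp γ : ℂ) + y * Complex.I ∈ Complex.slitPlane :=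
      Complex.mem_slitPlane_iff.2 (Or.inl (by simpa [-Complex.ofReal_exp] using Real.exp_pos γ))
    have h2 := kernel_conj a γ θ hsl
    have h3 : (starRingEnd ℂ) ((Real.exp γ : ℂ) + y * Complex.I) =
        (Real.exp γ : ℂ) + ((-y : ℝ) : ℂ) * Complex.I := by
      simp only [map_add, map_mul, Complex.conj_ofReal, Complex.conj_I]
      push_cast
      ring
    rw [h, ← h3, h2, Complex.conj_re]

/-- The Laplace transform of a noncentral chi-square variable, along the vertical line through the
saddle point, in terms of `kernel`. -/
lemma exp_mul_laplace_eq {n Ω γ : ℝ} (hΩ : 0 < Ω) (hγ : 0 < γ) {τ : ℂ} (hτ : 0 < (1 + 2 * τ).re)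
    (hτ0 : τ ≠ 0) {a θ q : ℝ} (ha : a = n / (2 * Real.sinh γ))
    (hθ : θ = Real.log (Ω / (2 * Real.sinh γ))) (hq : q = n * Ω / (4 * Real.sinh γ ^ 2)) :
    Complex.exp (τ * q) * (Complex.exp (-(n / 2 : ℝ) * Complex.log (1 + 2 * τ) -
      (n / Ω : ℝ) * (τ / (1 + 2 * τ))) * (1 / τ)) =
      -(2 * Real.exp θ * Real.exp (a * alpha γ θ) : ℝ) *
        kernel a γ θ (Real.exp θ * (1 + 2 * τ)) := by
  have hs := Real.sinh_pos_iff.2 hγ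
  set p : ℂ := 1 + 2 * τ with hp
  have hp0 : p ≠ 0 := by
    intro h; rw [h] at hτ; simp at hτ
  have hτp : τ = (p - 1) / 2 := by rw [hp]; ring
  have heθ : Real.exp θ = Ω / (2 * Real.sinh γ) := by
    rw [hθ, Real.exp_log (by positivity)]
  have hlog : Complex.log (Real.exp θ * p) = θ + Complex.log p := by
    rw [Complex.log_ofReal_mul (Real.exp_pos θ) hp0, Real.log_exp]
  have hsC : (Real.sinh γ : ℂ) ≠ 0 := by exact_mod_cast hs.ne'
  have hΩC : (Ω : ℂ) ≠ 0 := by exact_mod_cast hΩ.ne'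
  have heC : (Real.exp θ : ℂ) = Ω / (2 * Real.sinh γ) := by
    rw [heθ]; push_cast; rfl
  have hcosh : Complex.cosh (Complex.log (Real.exp θ * p)) =
      (Real.exp θ * p + (Real.exp θ * p)⁻¹) / 2 := by
    have h0 : (Real.exp θ : ℂ) * p ≠ 0 :=
      mul_ne_zero (by exact_mod_cast (Real.exp_pos θ).ne') hp0
    rw [Complex.cosh, Complex.exp_neg, Complex.exp_log h0]
  have hcoshθ : (Real.cosh θ : ℂ) = ((Real.exp θ : ℂ) + (Real.exp θ : ℂ)⁻¹) / 2 := by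
    rw [Real.cosh_eq, Real.exp_neg]; push_cast; rfl
  -- With `p = 1 + 2τ`, the relations `q = a e^θ`, `n/Ω = a e^{-θ}` and `n/2 = a sinh γ` make the
  -- total exponent equal to `a(α(θ) - α(ln(e^θ p)))`.
  have hexp : Complex.exp (τ * q) * Complex.exp (-(n / 2 : ℝ) * Complex.log p -
      (n / Ω : ℝ) * (τ / p)) = (Real.exp (a * alpha γ θ) : ℂ) *
      Complex.exp (-(a : ℂ) * alphaC γ (Complex.log (Real.exp θ * p))) := by
    rw [Complex.ofReal_exp, ← Complex.exp_add, ← Complex.exp_add]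
    congr 1
    rw [alphaC, hcosh, hlog, alpha]
    push_cast [-Complex.ofReal_cosh, -Complex.ofReal_sinh, -Complex.ofReal_exp]
    rw [hcoshθ, heC, hτp, ha, hq]
    push_cast [-Complex.ofReal_cosh, -Complex.ofReal_sinh, -Complex.ofReal_exp]
    field_simp
    ring
  rw [← mul_assoc, hexp, kernel]
  have hden : (Real.exp θ : ℂ) - Real.exp θ * p = -(2 * Real.exp θ * τ) := by
    rw [hp]; ring
  have he0 : (Real.exp θ : ℂ) ≠ 0 := by exact_mod_cast (Real.exp_pos θ).ne'
  rw [hden]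
  push_cast [-Complex.ofReal_exp]
  field_simp

/-- The abscissa `c = (e^{γ-θ} - 1)/2` is the one that sends the line to the vertical line through
`e^γ`. Its sign decides which one-sided step function has a Laplace transform there, namely `1/τ` or
`-1/τ`; `σ` covers both. -/
theorem expectation_step_eq {S : Type*} [MeasurableSpace S] {μ : Measure S}
    [IsProbabilityMeasure μ] {Q : S → ℝ} (hQ : Measurable Q) {n Ω γ : ℝ} (hn : 0 < n)
    (hΩ : 0 < Ω) (hγ : 0 < γ) {a θ q : ℝ} (ha : a = n / (2 * Real.sinh γ))
    (hθ : θ = Real.log (Ω / (2 * Real.sinh γ))) (hq : q = n * Ω / (4 * Real.sinh γ ^ 2))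
    (hγθ : γ ≠ θ) (hM : ∀ τ : ℂ, 0 < (1 + 2 * τ).re → ∫ ω, Complex.exp (-τ * Q ω) ∂μ =
      Complex.exp (-(n / 2 : ℝ) * Complex.log (1 + 2 * τ) - (n / Ω : ℝ) * (τ / (1 + 2 * τ))))
    (hq0 : μ {ω | Q ω = q} = 0) {k : ℝ → ℝ} (hk : Measurable k)
    (hk1 : ∀ u, |k u| ≤ 1) (hkc : ∀ u, u ≠ 0 → ContinuousAt k u) {σ : ℝ}
    (hck : Integrable (fun u => Real.exp (-((Real.exp (γ - θ) - 1) / 2) * u) * k u))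
    (hkτ : ∀ τ : ℂ, τ.re = (Real.exp (γ - θ) - 1) / 2 →
      ∫ u : ℝ, Complex.exp (-τ * u) * k u = σ * (1 / τ)) :
    ∫ ω, k (q - Q ω) ∂μ = -σ * Real.exp (a * alpha γ θ) / (2 * Real.pi) *
      ∫ y : ℝ, (kernel a γ θ (Real.exp γ + y * Complex.I)).re := by
  have hs := Real.sinh_pos_iff.2 hγ
  set c := (Real.exp (γ - θ) - 1) / 2 with hc
  have ha0 : 0 < a := by rw [ha]; positivity
  have hker := integrable_kernel_line ha0 hγ hγθ
  have hc0 : c ≠ 0 := by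
    intro h
    have h1 : Real.exp (γ - θ) = 1 := by linarith
    rw [Real.exp_eq_one_iff] at h1
    exact hγθ (by linarith)
  let C : ℂ := -(σ * (2 * Real.exp θ * Real.exp (a * alpha γ θ)) : ℝ)
  let τ : ℝ → ℂ := fun ξ => c + 2 * Real.pi * ξ * Complex.I
  have hτre : ∀ ξ, (τ ξ).re = c := by intro ξ; simp [τ]
  have hx : ∀ ξ : ℝ, (Real.exp θ : ℂ) * (1 + 2 * τ ξ) =
      Real.exp γ + ((4 * Real.pi * Real.exp θ * ξ : ℝ) : ℂ) * Complex.I := by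
    intro ξ
    have h1 : (Real.exp γ : ℂ) = Real.exp θ * Real.exp (γ - θ) := by
      rw [← Complex.ofReal_mul, ← Real.exp_add]; congr 2; ring
    rw [h1]
    simp only [τ, hc]
    push_cast
    ring
  let Φ : ℝ → ℂ := fun ξ => Complex.exp (-τ ξ * q) * (C *
    kernel a γ θ (Real.exp γ + ((4 * Real.pi * Real.exp θ * ξ : ℝ) : ℂ) * Complex.I))
  have hΦi : Integrable Φ := by
    refine Integrable.bdd_mul (c := Real.exp (-c * q)) ?_ ?_ ?_
    · exact (hker.comp_mul_left' (by positivity : (4 * Real.pi * Real.exp θ) ≠ 0)).const_mul C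
    · exact Continuous.aestronglyMeasurable (by simp only [τ]; fun_prop)
    · refine Eventually.of_forall fun ξ => ?_
      rw [Complex.norm_exp]
      simp [hτre]
  have hcre : (0 : ℝ) < (1 + 2 * (c : ℂ)).re := by
    have h : (1 + 2 * (c : ℂ)).re = 1 + 2 * c := by simp
    rw [h]
    linarith [Real.exp_pos (γ - θ)]
  have hcQ : Integrable (fun ω => Real.exp (-c * Q ω)) μ := by
    have h1 : Integrable (fun ω => Complex.exp (-(c : ℂ) * Q ω)) μ := by
      -- A non-integrable function would have Bochner integral `0`, while `hM` gives an exponential.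
      by_contra h
      have h2 := hM c hcre
      rw [integral_undef h] at h2
      exact Complex.exp_ne_zero _ h2.symm
    refine h1.norm.congr (Eventually.of_forall fun ω => ?_)
    simp [Complex.norm_exp]
  have hΦ : ∀ ξ : ℝ, (∫ ω, Complex.exp (-(c + 2 * Real.pi * ξ * Complex.I) * Q ω) ∂μ) *
      (∫ u : ℝ, Complex.exp (-(c + 2 * Real.pi * ξ * Complex.I) * u) * k u) = Φ ξ := by
    intro ξ
    have hτ1 : 0 < (1 + 2 * τ ξ).re := by
      simpa [hτre] using hcre
    have hτ0 : τ ξ ≠ 0 := by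
      intro h; apply hc0; rw [← hτre ξ, h, Complex.zero_re]
    have h1 := exp_mul_laplace_eq hΩ hγ hτ1 hτ0 ha hθ hq
    rw [hx] at h1
    change (∫ ω, Complex.exp (-τ ξ * Q ω) ∂μ) * (∫ u : ℝ, Complex.exp (-τ ξ * u) * k u) = _
    rw [hM _ hτ1, hkτ _ (hτre ξ)]
    have h2 : Complex.exp (-τ ξ * q) * Complex.exp (τ ξ * q) = 1 := by
      rw [← Complex.exp_add]; simp
    have h3 : C = σ * -(2 * Real.exp θ * Real.exp (a * alpha γ θ) : ℝ) := by
      simp only [C]; push_cast; ring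
    simp only [Φ]
    rw [h3, mul_assoc (σ : ℂ), ← h1]
    linear_combination (-(σ : ℂ) * Complex.exp (-(n / 2 : ℝ) * Complex.log (1 + 2 * τ ξ) -
      (n / Ω : ℝ) * (τ ξ / (1 + 2 * τ ξ))) * (1 / τ ξ)) * h2
  have hmain := expectation_eq_laplace_inversion hQ hk hk1 hkc hck hcQ hq0 hΦ hΦi
  have h4 : ∀ ξ : ℝ, Complex.exp (2 * Real.pi * ξ * q * Complex.I) * Φ ξ =
      Complex.exp (-(c * q)) * (C * kernel a γ θ (Real.exp γ +
        ((4 * Real.pi * Real.exp θ * ξ : ℝ) : ℂ) * Complex.I)) := by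
    intro ξ
    simp only [Φ]
    rw [← mul_assoc, ← Complex.exp_add]
    congr 2
    simp only [τ]
    ring
  simp_rw [h4] at hmain
  rw [integral_const_mul, ← mul_assoc, ← Complex.exp_add, add_neg_cancel, Complex.exp_zero,
    one_mul, integral_const_mul, Measure.integral_comp_mul_left (fun y : ℝ =>
      kernel a γ θ (Real.exp γ + (y : ℂ) * Complex.I)) (4 * Real.pi * Real.exp θ),
    abs_of_pos (by positivity)] at hmain
  have h5 := congrArg Complex.re hmain
  have h6 : (∫ y : ℝ, kernel a γ θ (Real.exp γ + y * Complex.I)).re =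
      ∫ y : ℝ, (kernel a γ θ (Real.exp γ + y * Complex.I)).re :=
    (integral_re hker).symm
  simp only [C] at h5
  rw [Complex.ofReal_re, ← Complex.ofReal_neg, Complex.re_ofReal_mul, Complex.smul_re, h6,
    smul_eq_mul] at h5
  rw [h5]
  generalize ∫ y : ℝ, (kernel a γ θ (Real.exp γ + y * Complex.I)).re = J
  have := Real.exp_pos θ
  have := Real.pi_pos
  field_simp
  ring

/-- The distribution function of a noncentral chi-square variable as an integral along the path
of steepest descent. -/
theorem measure_le_eq {S : Type*} [MeasurableSpace S] {μ : Measure S}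
    [IsProbabilityMeasure μ] {Q : S → ℝ} (hQ : Measurable Q) {n Ω γ : ℝ} (hn : 0 < n)
    (hΩ : 0 < Ω) (hγ : 0 < γ) {a θ q : ℝ} (ha : a = n / (2 * Real.sinh γ))
    (hθ : θ = Real.log (Ω / (2 * Real.sinh γ))) (hq : q = n * Ω / (4 * Real.sinh γ ^ 2))
    (hM : ∀ τ : ℂ, 0 < (1 + 2 * τ).re → ∫ ω, Complex.exp (-τ * Q ω) ∂μ =
      Complex.exp (-(n / 2 : ℝ) * Complex.log (1 + 2 * τ) - (n / Ω : ℝ) * (τ / (1 + 2 * τ))))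
    (hq0 : μ {ω | Q ω = q} = 0) {Ω' : ℝ} {b : ErrorType} (hb : theta Ω' γ b = θ) :
    (θ < γ → μ.real {ω | Q ω ≤ q} = -(Real.exp (a * alpha γ θ) / Real.pi *
      ∫ φ in Ioo 0 Real.pi, Real.exp (-a * hPhi γ φ) * gTilde Ω' γ b φ)) ∧
    (γ < θ → μ.real {ω | q < Q ω} = Real.exp (a * alpha γ θ) / Real.pi *
      ∫ φ in Ioo 0 Real.pi, Real.exp (-a * hPhi γ φ) * gTilde Ω' γ b φ) := by
  have hs := Real.sinh_pos_iff.2 hγ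
  have ha0 : 0 < a := by rw [ha]; positivity
  have hπ := Real.pi_pos
  have hcontour : ∀ h : γ ≠ θ, ∫ y : ℝ, (kernel a γ θ (Real.exp γ + y * Complex.I)).re =
      2 * ∫ φ in Ioo 0 Real.pi, Real.exp (-a * hPhi γ φ) * gTilde Ω' γ b φ := by
    intro h
    rw [integral_re_kernel_line, integral_kernel_line_eq ha0 hγ h hb
      (integrableOn_gTilde ha0.le hγ (by rwa [hb]))
      (integrable_kernel_line ha0 hγ h).re.integrableOn]
  have hcA : ∀ (A : Set ℝ) (u : ℝ), |A.indicator (fun _ => (1 : ℝ)) u| ≤ 1 := by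
    intro A u
    by_cases h : u ∈ A <;> simp [h]
  have hcont : ∀ u : ℝ, u ≠ 0 → ContinuousAt ((Ici (0 : ℝ)).indicator fun _ => (1 : ℝ)) u ∧
      ContinuousAt ((Iio (0 : ℝ)).indicator fun _ => (1 : ℝ)) u := by
    intro u hu
    rcases lt_or_gt_of_ne hu with h | h
    · constructor
      · refine (continuousAt_const (y := (0 : ℝ))).congr ?_
        filter_upwards [Iio_mem_nhds h] with z hz
        exact (indicator_of_notMem (notMem_Ici.2 hz) _).symm
      · refine (continuousAt_const (y := (1 : ℝ))).congr ?_
        filter_upwards [Iio_mem_nhds h] with z hz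
        exact (indicator_of_mem (show z ∈ Iio (0 : ℝ) from hz) fun _ => (1 : ℝ)).symm
    · constructor
      · refine (continuousAt_const (y := (1 : ℝ))).congr ?_
        filter_upwards [Ioi_mem_nhds h] with z hz
        exact (indicator_of_mem (show z ∈ Ici (0 : ℝ) from le_of_lt (mem_Ioi.1 hz)) fun _ => (1 : ℝ)).symm
      · refine (continuousAt_const (y := (0 : ℝ))).congr ?_
        filter_upwards [Ioi_mem_nhds h] with z hz
        exact (indicator_of_notMem (notMem_Iio.2 (show (0 : ℝ) ≤ z from le_of_lt (mem_Ioi.1 hz))) _).symm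
  constructor
  · intro h
    have hc : 0 < (Real.exp (γ - θ) - 1) / 2 := by
      -- For `c > 0` the transform of the indicator of `[0, ∞)` converges and equals `1/τ`.
      have := Real.one_lt_exp_iff.2 (sub_pos.2 h); linarith
    have h1 := expectation_step_eq (σ := 1) hQ hn hΩ hγ ha hθ hq h.ne' hM hq0
      (k := (Ici (0 : ℝ)).indicator fun _ => 1) (measurable_const.indicator measurableSet_Ici)
      (hcA _) (fun u hu => (hcont u hu).1) ?_ ?_
    · have h2 : (fun ω => (Ici (0 : ℝ)).indicator (fun _ => (1 : ℝ)) (q - Q ω)) =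
          {ω | Q ω ≤ q}.indicator 1 := by
        ext ω
        simp [indicator, sub_nonneg]
      rw [h2, integral_indicator_one (measurableSet_le hQ measurable_const), hcontour h.ne'] at h1
      rw [h1]
      field_simp
    · have h3 := (integrableOn_exp_mul_Ioi (neg_neg_of_pos hc) 0)
      rw [← integrableOn_Ici_iff_integrableOn_Ioi] at h3
      refine ((integrable_indicator_iff measurableSet_Ici).2 h3).congr
        (Eventually.of_forall fun u => ?_)
      by_cases hu : u ∈ Ici (0 : ℝ) <;> simp [hu]
    · intro τ hτ
      have hre : (-τ).re < 0 := by rw [Complex.neg_re, hτ]; linarith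
      have h4 : ∀ u : ℝ, Complex.exp (-τ * u) * ((Ici (0 : ℝ)).indicator (fun _ => (1 : ℝ)) u : ℝ) =
          (Ici (0 : ℝ)).indicator (fun u : ℝ => Complex.exp (-τ * u)) u := by
        intro u
        by_cases hu : u ∈ Ici (0 : ℝ) <;> simp [hu]
      simp_rw [h4]
      rw [integral_indicator measurableSet_Ici, integral_Ici_eq_integral_Ioi,
        integral_exp_mul_complex_Ioi hre]
      simp
  · intro h
    have hc : (Real.exp (γ - θ) - 1) / 2 < 0 := by
      -- For `c < 0` it is the indicator of `(-∞, 0)`, with transform `-1/τ`.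
      have h0 := Real.exp_lt_exp.2 (sub_neg.2 h)
      rw [Real.exp_zero] at h0
      linarith
    have h1 := expectation_step_eq (σ := -1) hQ hn hΩ hγ ha hθ hq h.ne hM hq0
      (k := (Iio (0 : ℝ)).indicator fun _ => 1) (measurable_const.indicator measurableSet_Iio)
      (hcA _) (fun u hu => (hcont u hu).2) ?_ ?_
    · have h2 : (fun ω => (Iio (0 : ℝ)).indicator (fun _ => (1 : ℝ)) (q - Q ω)) =
          {ω | q < Q ω}.indicator 1 := by
        ext ω
        simp [indicator, sub_neg]
      rw [h2, integral_indicator_one (measurableSet_lt measurable_const hQ), hcontour h.ne] at h1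
      rw [h1]
      field_simp
    · have h3 := (integrableOn_exp_mul_Iic (neg_pos.2 hc) 0)
      rw [integrableOn_Iic_iff_integrableOn_Iio] at h3
      refine ((integrable_indicator_iff measurableSet_Iio).2 h3).congr
        (Eventually.of_forall fun u => ?_)
      by_cases hu : u ∈ Iio (0 : ℝ) <;> simp [hu]
    · intro τ hτ
      have hre : 0 < (-τ).re := by rw [Complex.neg_re, hτ]; linarith
      have h4 : ∀ u : ℝ, Complex.exp (-τ * u) * ((Iio (0 : ℝ)).indicator (fun _ => (1 : ℝ)) u : ℝ) =
          (Iio (0 : ℝ)).indicator (fun u : ℝ => Complex.exp (-τ * u)) u := by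
        intro u
        by_cases hu : u ∈ Iio (0 : ℝ) <;> simp [hu]
      simp_rw [h4]
      rw [integral_indicator measurableSet_Iio, ← integral_Iic_eq_integral_Iio,
        integral_exp_mul_complex_Iic hre]
      simp

/-! ### The Gaussian quadratic form -/

/-- A Gaussian integral with complex quadratic coefficient. `Re(1 + 2τ) > 0` gives convergence and
keeps `1 + 2τ` off the branch cut, so the principal square root can be written with `log`. -/
lemma integral_exp_sq_gaussianReal {v : NNReal} (hv : 0 < v) (m b : ℝ) {τ : ℂ}
    (hτ : 0 < (1 + 2 * τ).re) :
    ∫ y, Complex.exp (-τ * ((y - b) ^ 2 / v : ℝ)) ∂(ProbabilityTheory.gaussianReal m v) =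
      Complex.exp (-(1 / 2) * Complex.log (1 + 2 * τ) -
        ((m - b) ^ 2 / v : ℝ) * (τ / (1 + 2 * τ))) := by
  have hvr : (0 : ℝ) < v := hv
  have hvC : ((v : ℝ) : ℂ) ≠ 0 := by exact_mod_cast hvr.ne'
  set p : ℂ := 1 + 2 * τ with hp
  have hp0 : p ≠ 0 := by
    intro h; rw [h] at hτ; simp at hτ
  rw [ProbabilityTheory.integral_gaussianReal_eq_integral_smul hv.ne']
  have h1 : ∀ y : ℝ, ProbabilityTheory.gaussianPDFReal m v y •
      Complex.exp (-τ * ((y - b) ^ 2 / v : ℝ)) = ((√(2 * Real.pi * v))⁻¹ : ℝ) *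
      Complex.exp (-(p / (2 * v)) * (y : ℂ) ^ 2 + ((m + 2 * τ * b) / v) * y +
        (-(m ^ 2 + 2 * τ * b ^ 2) / (2 * v))) := by
    intro y
    rw [ProbabilityTheory.gaussianPDFReal, Complex.real_smul, Complex.ofReal_mul,
      Complex.ofReal_exp, mul_assoc, ← Complex.exp_add]
    congr 2
    push_cast
    rw [hp]
    field_simp
    ring
  simp_rw [h1]
  have hre : (-(p / (2 * (v : ℝ)) : ℂ)).re < 0 := by
    have : p / (2 * ((v : ℝ) : ℂ)) = ((1 / (2 * (v : ℝ)) : ℝ) : ℂ) * p := by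
      push_cast; field_simp
    rw [this, Complex.neg_re, Complex.re_ofReal_mul]
    have : 0 < 1 / (2 * (v : ℝ)) * p.re := by positivity
    linarith
  rw [integral_const_mul, integral_cexp_quadratic hre]
  have h2 : ((Real.pi : ℂ) / - -(p / (2 * (v : ℝ)))) = ((2 * Real.pi * v : ℝ) : ℂ) * p⁻¹ := by
    push_cast; field_simp
  have hpos : 0 < 2 * Real.pi * (v : ℝ) := by positivity
  have harg : p.arg ≠ Real.pi := by
    intro h
    rw [Complex.arg_eq_pi_iff] at h
    linarith [h.1]
  rw [h2, Complex.cpow_def_of_ne_zero (mul_ne_zero (by exact_mod_cast hpos.ne')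
    (inv_ne_zero hp0)), Complex.log_ofReal_mul hpos (inv_ne_zero hp0), Complex.log_inv _ harg,
    ← mul_assoc]
  have h3 : (((√(2 * Real.pi * v))⁻¹ : ℝ) : ℂ) =
      Complex.exp (-(Real.log (2 * Real.pi * v)) / 2 : ℝ) := by
    rw [← Complex.ofReal_exp, Real.sqrt_eq_rpow, Real.rpow_def_of_pos hpos, ← Real.exp_neg]
    congr 2; ring
  rw [h3, ← Complex.exp_add, ← Complex.exp_add]
  congr 1
  push_cast
  have hτp : τ = (p - 1) / 2 := by rw [hp]; ring
  rw [hτp]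
  field_simp
  ring

lemma integral_exp_quadForm {n : ℕ} {v : NNReal} (hv : 0 < v) (m b : Fin n → ℝ) {τ : ℂ}
    (hτ : 0 < (1 + 2 * τ).re) :
    ∫ y, Complex.exp (-τ * (∑ i, (y i - b i) ^ 2 / v : ℝ))
      ∂(Measure.pi fun i => ProbabilityTheory.gaussianReal (m i) v) =
      Complex.exp (-((n : ℝ) / 2 : ℝ) * Complex.log (1 + 2 * τ) -
        (∑ i, (m i - b i) ^ 2 / v : ℝ) * (τ / (1 + 2 * τ))) := by
  have h1 : ∀ y : Fin n → ℝ, Complex.exp (-τ * (∑ i, (y i - b i) ^ 2 / v : ℝ)) =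
      ∏ i, Complex.exp (-τ * ((y i - b i) ^ 2 / v : ℝ)) := by
    intro y
    rw [← Complex.exp_sum, Complex.ofReal_sum, Finset.mul_sum]
  simp_rw [h1]
  rw [integral_fintype_prod_eq_prod (f := fun i (y : ℝ) =>
    Complex.exp (-τ * ((y - b i) ^ 2 / v : ℝ)))]
  simp_rw [integral_exp_sq_gaussianReal hv _ _ hτ]
  rw [← Complex.exp_sum, Finset.sum_sub_distrib, Finset.sum_const, Complex.ofReal_sum,
    Finset.sum_mul, Finset.card_univ, Fintype.card_fin, nsmul_eq_mul]
  congr 2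
  push_cast
  ring

/-- Once the other coordinates are fixed, the first one has at most two possible values, and
Gaussian measures have no atoms. -/
lemma pi_gaussianReal_quadForm_eq_zero {n : ℕ} (hn : 1 ≤ n) {v : NNReal} (hv : 0 < v)
    (m b : Fin n → ℝ) (q : ℝ) :
    (Measure.pi fun i => ProbabilityTheory.gaussianReal (m i) v)
      {y : Fin n → ℝ | ∑ i, (y i - b i) ^ 2 / v = q} = 0 := by
  obtain ⟨k, rfl⟩ : ∃ k, n = k + 1 := ⟨n - 1, by omega⟩
  have hvr : (0 : ℝ) < v := hv
  set μ : Fin (k + 1) → Measure ℝ := fun i => ProbabilityTheory.gaussianReal (m i) v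
  let A : Set (ℝ × (Fin k → ℝ)) :=
    {z | (z.1 - b 0) ^ 2 / v + ∑ i, (z.2 i - b i.succ) ^ 2 / v = q}
  have hA : MeasurableSet A := by
    refine measurableSet_eq_fun ?_ measurable_const
    fun_prop
  have hpre : {y : Fin (k + 1) → ℝ | ∑ i, (y i - b i) ^ 2 / v = q} =
      MeasurableEquiv.piFinSuccAbove (fun _ => ℝ) 0 ⁻¹' A := by
    ext y
    simp [A, Fin.sum_univ_succ, MeasurableEquiv.piFinSuccAbove, Fin.tail]
  rw [hpre, (measurePreserving_piFinSuccAbove μ 0).measure_preimage hA.nullMeasurableSet,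
    Measure.prod_apply_symm hA]
  refine lintegral_eq_zero_of_ae_eq_zero (Eventually.of_forall fun y => ?_)
  have hfin : ((fun x => (x, y)) ⁻¹' A).Finite := by
    set r := v * (q - ∑ i, (y i - b i.succ) ^ 2 / v)
    refine (Set.toFinite {b 0 + √r, b 0 - √r}).subset ?_
    intro x hx
    have hx : (x - b 0) ^ 2 / v + ∑ i, (y i - b i.succ) ^ 2 / v = q := hx
    have h1 : (x - b 0) ^ 2 = r := by
      simp only [r]
      rw [← hx]
      field_simp
      ring
    have h2 : |x - b 0| = √r := by rw [← h1, Real.sqrt_sq_eq_abs]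
    rw [← h2]
    rcases abs_choice (x - b 0) with h | h <;> rw [h] <;> simp
  have := ProbabilityTheory.nullSingletonClass_gaussianReal (μ := m 0) hv.ne'
  exact hfin.measure_zero _

/-! ### The likelihood ratio test -/

/-- The centre of the spheres on which the log-likelihood ratio is constant. -/
noncomputable def llrCenter {n : ℕ} (vx vw : NNReal) (x : EuclideanSpace ℝ (Fin n)) : Fin n → ℝ :=
  fun i => x i * ((1 + snr vx vw) / snr vx vw)

lemma log_gaussianPDFReal {v : NNReal} (hv : 0 < v) (m y : ℝ) :
    Real.log (ProbabilityTheory.gaussianPDFReal m v y) =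
      -(Real.log (2 * Real.pi) + Real.log v) / 2 - (y - m) ^ 2 / (2 * v) := by
  have hvr : (0 : ℝ) < v := hv
  have hpos : 0 < 2 * Real.pi * (v : ℝ) := by positivity
  rw [ProbabilityTheory.gaussianPDFReal, Real.log_mul (by positivity) (Real.exp_pos _).ne',
    Real.log_exp, Real.log_inv, Real.log_sqrt hpos.le, Real.log_mul (by positivity) hvr.ne']
  ring

lemma sum_sq_of_mem_codewords {n : ℕ} {vx : NNReal} {x : EuclideanSpace ℝ (Fin n)}
    (hx : x ∈ codewords n vx) : ∑ i, x i ^ 2 = n * (vx : ℝ) := by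
  have h : ‖x‖ ^ 2 = n * (vx : ℝ) := hx
  rw [EuclideanSpace.norm_sq_eq] at h
  simpa using h

/-- Completing the square in `y` in the difference of the two Gaussian exponents. Constant energy of
`x` removes its other influence on the constant term. -/
lemma llr_eq {n : ℕ} (hn : 1 ≤ n) {vx vw : NNReal} (hvx : 0 < vx) (hvw : 0 < vw) (γ : ℝ)
    {x : EuclideanSpace ℝ (Fin n)} (hx : x ∈ codewords n vx) (y : Fin n → ℝ) :
    llr vx vw x y = threshold (snr vx vw) γ +
      snr vx vw / (1 + snr vx vw) / (2 * n) * (n * (snr vx vw / (4 * Real.sinh γ ^ 2)) -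
        (∑ i, (y i - llrCenter vx vw x i) ^ 2) / vw) := by
  have hvxr : (0 : ℝ) < vx := hvx
  have hvwr : (0 : ℝ) < vw := hvw
  have hnr : (0 : ℝ) < n := by exact_mod_cast hn
  have hsum := sum_sq_of_mem_codewords hx
  have hv2 : 0 < vx + vw := by positivity
  have hlog : Real.log ((vx + vw : NNReal) : ℝ) = Real.log vw + Real.log (1 + snr vx vw) := by
    rw [← Real.log_mul hvwr.ne' (by unfold snr; positivity)]
    congr 1
    rw [snr]
    push_cast
    field_simp
    ring
  have h1 : Real.log (densH1 vw x y / densH0 vx vw y) =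
      ∑ i, (Real.log (1 + snr vx vw) / 2 + x i ^ 2 / (2 * vx) -
        snr vx vw / (1 + snr vx vw) / (2 * vw) * (y i - llrCenter vx vw x i) ^ 2) := by
    rw [densH1, densH0, ← Finset.prod_div_distrib, Real.log_prod]
    · refine Finset.sum_congr rfl fun i _ => ?_
      rw [Real.log_div (ProbabilityTheory.gaussianPDFReal_pos _ _ _ hvw.ne').ne'
        (ProbabilityTheory.gaussianPDFReal_pos _ _ _ hv2.ne').ne', log_gaussianPDFReal hvw,
        log_gaussianPDFReal hv2, hlog, llrCenter]
      generalize Real.log (1 + snr vx vw) = l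
      rw [snr]
      push_cast
      field_simp
      ring
    · intro i _
      exact (div_pos (ProbabilityTheory.gaussianPDFReal_pos _ _ _ hvw.ne')
        (ProbabilityTheory.gaussianPDFReal_pos _ _ _ hv2.ne')).ne'
  rw [llr, h1, Finset.sum_sub_distrib, Finset.sum_add_distrib, ← Finset.mul_sum, ← Finset.sum_div,
    ← Finset.sum_div, hsum, Finset.sum_const, Finset.card_univ, Fintype.card_fin, nsmul_eq_mul, threshold]
  have h2 : 0 < 1 + snr vx vw := by unfold snr; positivity
  generalize snr vx vw / (4 * Real.sinh γ ^ 2) = l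
  generalize ∑ i, (y i - llrCenter vx vw x i) ^ 2 = t
  field_simp
  ring

/-! ### The error probabilities -/

instance {n : ℕ} (vw : NNReal) (x : EuclideanSpace ℝ (Fin n)) :
    IsProbabilityMeasure (lawH1 vw x) := by
  unfold lawH1; infer_instance

instance (n : ℕ) (vx vw : NNReal) : IsProbabilityMeasure (lawH0 n vx vw) := by
  unfold lawH0; infer_instance

/-- The effective signal to noise ratio under the hypothesis at which the error occurs. -/
noncomputable def effSnr (Ω : ℝ) : ErrorType → ℝ
  | .MD => Ω
  | .FA => Ω / (1 + Ω)

/-- The sign with which the contour integral enters the error probability. -/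
def errSign : ErrorType → ℝ
  | .MD => 1
  | .FA => -1

/-- This brings FA into the same form as MD, so that `measure_le_eq` serves both. -/
lemma theta_eq_log_effSnr {Ω γ : ℝ} (hΩ : 0 < Ω) (hγ : 0 < γ) (b : ErrorType) :
    theta Ω γ b = Real.log (effSnr Ω b / (2 * Real.sinh γ)) := by
  have hs := Real.sinh_pos_iff.2 hγ
  cases b
  · rfl
  · rw [theta, effSnr, ← Real.log_div (by positivity) (by positivity)]
    congr 1
    field_simp

theorem errorProb_eq {n : ℕ} (hn : 1 ≤ n) {vx vw : NNReal} (hvx : 0 < vx) (hvw : 0 < vw) {γ : ℝ}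
    (hγ : 0 < γ) {x : EuclideanSpace ℝ (Fin n)} (hx : x ∈ codewords n vx)
    (hMD : γ < theta (snr vx vw) γ .MD) (hFA : theta (snr vx vw) γ .FA < γ) (b : ErrorType) :
    errorProb vx vw x (threshold (snr vx vw) γ) b = errSign b *
      (Real.exp (n / (2 * Real.sinh γ) * alpha γ (theta (snr vx vw) γ b)) / Real.pi *
        ∫ φ in Ioo 0 Real.pi, Real.exp (-(n / (2 * Real.sinh γ)) * hPhi γ φ) *
          gTilde (snr vx vw) γ b φ) := by
  have hvxr : (0 : ℝ) < vx := hvx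
  have hvwr : (0 : ℝ) < vw := hvw
  have hs := Real.sinh_pos_iff.2 hγ
  have hnr : (0 : ℝ) < n := by exact_mod_cast hn
  have hv2 : 0 < vx + vw := by positivity
  have hΩ : 0 < snr vx vw := div_pos hvxr hvwr
  have hsum := sum_sq_of_mem_codewords hx
  set Ω := snr vx vw with hΩd
  have hvxΩ : (vx : ℝ) = Ω * vw := by rw [hΩd, snr]; field_simp
  have hcoef : 0 < Ω / (1 + Ω) / (2 * n) := by positivity
  have hle : ∀ y, threshold Ω γ ≤ llr vx vw x y ↔
      (∑ i, (y i - llrCenter vx vw x i) ^ 2) / vw ≤ n * (Ω / (4 * Real.sinh γ ^ 2)) := by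
    intro y
    rw [llr_eq hn hvx hvw γ hx, le_add_iff_nonneg_right, mul_nonneg_iff_of_pos_left hcoef,
      sub_nonneg]
  have hmeasQ : ∀ v : NNReal, Measurable fun y : Fin n → ℝ =>
      ∑ i, (y i - llrCenter vx vw x i) ^ 2 / (v : ℝ) := by
    intro v
    fun_prop
  cases b with
  | MD =>
    have hnu : ∑ i, (x i - llrCenter vx vw x i) ^ 2 / (vw : ℝ) = n / effSnr Ω .MD := by
      have h1 : ∀ i, (x i - llrCenter vx vw x i) ^ 2 / (vw : ℝ) = x i ^ 2 * (1 / (Ω ^ 2 * vw)) := by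
        intro i
        rw [llrCenter, ← hΩd]
        field_simp
        ring
      simp_rw [h1]
      rw [← Finset.sum_mul, hsum, hvxΩ, effSnr]
      field_simp
    have h := (measure_le_eq (μ := lawH1 vw x) (b := .MD) (Ω' := Ω) (n := n)
      (Ω := effSnr Ω .MD) (hmeasQ vw) hnr hΩ hγ rfl rfl rfl (fun τ hτ => by
        have := integral_exp_quadForm hvw (fun i => x i) (llrCenter vx vw x) hτ
        rwa [hnu] at this)
      (pi_gaussianReal_quadForm_eq_zero hn hvw (fun i => x i) _ _)
      (theta_eq_log_effSnr hΩ hγ .MD)).2 (by rwa [← theta_eq_log_effSnr hΩ hγ .MD])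
    rw [← theta_eq_log_effSnr hΩ hγ .MD] at h
    rw [errSign, one_mul, ← h, errorProb]
    congr 1
    ext y
    rw [mem_ofPred_eq, mem_ofPred_eq, ← not_le, hle, not_le, Finset.sum_div, effSnr, mul_div_assoc]
  | FA =>
    have hnu : ∑ i, ((0 : ℝ) - llrCenter vx vw x i) ^ 2 / ((vx + vw : NNReal) : ℝ) =
        n / effSnr Ω .FA := by
      have h1 : ∀ i, ((0 : ℝ) - llrCenter vx vw x i) ^ 2 / ((vx + vw : NNReal) : ℝ) =
          x i ^ 2 * ((1 + Ω) / (Ω ^ 2 * vw)) := by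
        intro i
        rw [llrCenter, ← hΩd]
        push_cast
        rw [hvxΩ]
        field_simp
        ring
      simp_rw [h1]
      rw [← Finset.sum_mul, hsum, hvxΩ, effSnr]
      field_simp
    have hΩ2 : 0 < effSnr Ω .FA := by rw [effSnr]; positivity
    have h := (measure_le_eq (μ := lawH0 n vx vw) (b := .FA) (Ω' := Ω) (n := n)
      (Ω := effSnr Ω .FA) (hmeasQ (vx + vw)) hnr hΩ2 hγ rfl rfl rfl (fun τ hτ => by
        have := integral_exp_quadForm hv2 (fun _ => 0) (llrCenter vx vw x) hτ
        rwa [hnu] at this)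
      (pi_gaussianReal_quadForm_eq_zero hn hv2 (fun _ => 0) _ _)
      (theta_eq_log_effSnr hΩ hγ .FA)).1 (by rwa [← theta_eq_log_effSnr hΩ hγ .FA])
    rw [← theta_eq_log_effSnr hΩ hγ .FA] at h
    rw [errSign, neg_one_mul, ← h, errorProb]
    congr 1
    ext y
    -- Under `H₀` the variance is `(1 + Ω) σ_w²`; rescaling by it replaces `Ω` by `Ω/(1+Ω)` in the
    -- threshold, as `hnu` does in the noncentrality.
    have h2 : ∀ z : ℝ, z / vw ≤ n * (Ω / (4 * Real.sinh γ ^ 2)) ↔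
        z / ((vx + vw : NNReal) : ℝ) ≤ n * (Ω / (1 + Ω)) / (4 * Real.sinh γ ^ 2) := by
      intro z
      have e1 : z / ((vx + vw : NNReal) : ℝ) = z / vw / (1 + Ω) := by
        push_cast
        rw [hvxΩ]
        field_simp
        ring
      have e2 : n * (Ω / (1 + Ω)) / (4 * Real.sinh γ ^ 2) =
          n * (Ω / (4 * Real.sinh γ ^ 2)) / (1 + Ω) := by
        field_simp
      rw [e1, e2, div_le_div_iff_of_pos_right (by positivity)]
    rw [mem_ofPred_eq, mem_ofPred_eq, hle, ← Finset.sum_div, effSnr, h2]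

/-! ### Comparison with the truncated series -/

/-- It turns the comparison of `γ` with `θ = ln(Ω'/(2 sinh γ))` into that of `e^{2γ}` with `1 + Ω'`.
-/
lemma exp_two_mul_sub_one (γ : ℝ) : Real.exp γ * (2 * Real.sinh γ) = Real.exp (2 * γ) - 1 := by
  rw [Real.sinh_eq, Real.exp_neg, two_mul γ, Real.exp_add]
  have := Real.exp_pos γ
  field_simp

lemma lt_theta_MD {Ω γ : ℝ} (hΩ : 0 < Ω) (hγ : 0 < γ)
    (h : γ < 1 / 2 * Real.log (1 + Ω)) : γ < theta Ω γ .MD := by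
  have hs := Real.sinh_pos_iff.2 hγ
  have h1 : Real.exp (2 * γ) < 1 + Ω := by
    rw [← Real.lt_log_iff_exp_lt (by linarith)]; linarith
  rw [theta_eq_log_effSnr hΩ hγ, Real.lt_log_iff_exp_lt (by unfold effSnr; positivity),
    lt_div_iff₀ (by positivity), exp_two_mul_sub_one, effSnr]
  linarith

lemma theta_FA_lt {Ω γ : ℝ} (hΩ : 0 < Ω) (hγ : 0 < γ)
    (h : 1 / 2 * Real.log (1 + Ω / (1 + Ω)) < γ) : theta Ω γ .FA < γ := by
  have hs := Real.sinh_pos_iff.2 hγ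
  have hp : 0 < Ω / (1 + Ω) := by positivity
  have h1 : 1 + Ω / (1 + Ω) < Real.exp (2 * γ) := by
    rw [← Real.log_lt_iff_lt_exp (by linarith)]; linarith
  rw [theta_eq_log_effSnr hΩ hγ, Real.log_lt_iff_lt_exp (by unfold effSnr; positivity),
    div_lt_iff₀ (by positivity), exp_two_mul_sub_one, effSnr]
  linarith

/-- Term by term this is `exp_mul_uPhi_pow` with `b = n/(4 sinh γ)`; the constants match because
`Γ(1/2) = √π`. -/
lemma gTrunc_eq_integral {n : ℕ} (hn : 1 ≤ n) {Ω γ : ℝ} (hγ : 0 < γ) (b : ErrorType) (K : ℕ) :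
    IntegrableOn (fun φ => Real.exp (-(n / (2 * Real.sinh γ)) * hPhi γ φ) *
      ((∑ k ∈ Finset.range K, cEven Ω γ b k * uPhi γ φ ^ (2 * k)) * (hPhi' γ φ / uPhi γ φ)))
      (Ioo 0 Real.pi) ∧
    gTrunc n Ω γ b K = 1 / Real.pi * ∫ φ in Ioo 0 Real.pi,
      Real.exp (-(n / (2 * Real.sinh γ)) * hPhi γ φ) *
      ((∑ k ∈ Finset.range K, cEven Ω γ b k * uPhi γ φ ^ (2 * k)) * (hPhi' γ φ / uPhi γ φ)) := by
  have hs := Real.sinh_pos_iff.2 hγ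
  have hnr : (0 : ℝ) < n := by exact_mod_cast hn
  have hb : (0 : ℝ) < n / (4 * Real.sinh γ) := by positivity
  have h2b : 2 * (n / (4 * Real.sinh γ)) = n / (2 * Real.sinh γ) := by field_simp; ring
  have hk := fun k => exp_mul_uPhi_pow hγ hb k
  rw [h2b] at hk
  have hfun : (fun φ => Real.exp (-(n / (2 * Real.sinh γ)) * hPhi γ φ) *
      ((∑ k ∈ Finset.range K, cEven Ω γ b k * uPhi γ φ ^ (2 * k)) *
        (hPhi' γ φ / uPhi γ φ))) = fun φ => ∑ k ∈ Finset.range K, cEven Ω γ b k *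
      (Real.exp (-(n / (2 * Real.sinh γ)) * hPhi γ φ) *
        (uPhi γ φ ^ (2 * k) * (hPhi' γ φ / uPhi γ φ))) := by
    ext φ
    rw [Finset.sum_mul, Finset.mul_sum]
    refine Finset.sum_congr rfl fun k _ => ?_
    ring
  rw [hfun]
  refine ⟨integrable_finsetSum _ fun k _ => (hk k).1.const_mul _, ?_⟩
  rw [integral_finsetSum _ fun k _ => (hk k).1.const_mul _, gTrunc, Finset.mul_sum,
    Finset.mul_sum]
  refine Finset.sum_congr rfl fun k _ => ?_
  rw [integral_const_mul, (hk k).2, Real.Gamma_one_half_eq, inv_div]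
  have h1 : √Real.pi ≠ 0 := (Real.sqrt_pos.2 Real.pi_pos).ne'
  have h2 : Real.pi ≠ 0 := Real.pi_pos.ne'
  generalize (4 * Real.sinh γ / (n : ℝ)) ^ ((k : ℝ) + 1 / 2) = w
  field_simp
  rw [Real.sq_sqrt Real.pi_pos.le]
  ring

lemma cEven_zero_mul_ratioTrunc {Ω γ : ℝ} {b : ErrorType} (h0 : cEven Ω γ b 0 ≠ 0) {K : ℕ}
    (hK : 1 ≤ K) (φ : ℝ) : cEven Ω γ b 0 * ratioTrunc Ω γ b K φ =
      ∑ k ∈ Finset.range K, cEven Ω γ b k * uPhi γ φ ^ (2 * k) := by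
  have h := Finset.sum_eq_sum_Ico_succ_bot (show 0 < K by omega)
    fun k => cEven Ω γ b k * uPhi γ φ ^ (2 * k)
  rw [ratioTrunc, Finset.range_eq_Ico, h, mul_add, Finset.mul_sum, mul_one, mul_zero, pow_zero, mul_one]
  congr 1
  refine Finset.sum_congr (by rw [zero_add]) fun k _ => ?_
  field_simp

lemma gTilde_eq {Ω γ : ℝ} (hγ : 0 < γ) (b : ErrorType) {φ : ℝ} (hφ : φ ∈ Ioo 0 Real.pi) :
    gTilde Ω γ b φ = cPhi Ω γ b φ * (hPhi' γ φ / uPhi γ φ) := by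
  have h1 := (hPhi'_pos γ hφ).ne'
  have h2 := (uPhi_pos hγ hφ).ne'
  rw [cPhi]
  field_simp

/-- Pointwise bounds on `cPhi` integrate to bounds on the contour integral. -/
lemma gTrunc_bounds {n : ℕ} (hn : 1 ≤ n) {Ω γ : ℝ} (hγ : 0 < γ) {b : ErrorType}
    (hθ : γ ≠ theta Ω γ b) (K : ℕ) :
    ((∀ φ ∈ Ioo 0 Real.pi, ∑ k ∈ Finset.range K, cEven Ω γ b k * uPhi γ φ ^ (2 * k) ≤
        cPhi Ω γ b φ) → gTrunc n Ω γ b K ≤ 1 / Real.pi * ∫ φ in Ioo 0 Real.pi,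
          Real.exp (-(n / (2 * Real.sinh γ)) * hPhi γ φ) * gTilde Ω γ b φ) ∧
    ((∀ φ ∈ Ioo 0 Real.pi, cPhi Ω γ b φ ≤
        ∑ k ∈ Finset.range K, cEven Ω γ b k * uPhi γ φ ^ (2 * k)) →
        1 / Real.pi * ∫ φ in Ioo 0 Real.pi, Real.exp (-(n / (2 * Real.sinh γ)) * hPhi γ φ) *
          gTilde Ω γ b φ ≤ gTrunc n Ω γ b K) := by
  have hs := Real.sinh_pos_iff.2 hγ
  obtain ⟨hi, he⟩ := gTrunc_eq_integral (Ω := Ω) hn hγ b K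
  have hg := integrableOn_gTilde (a := n / (2 * Real.sinh γ)) (b := b) (by positivity) hγ hθ
  rw [he]
  have hpos : ∀ φ ∈ Ioo 0 Real.pi, 0 ≤ hPhi' γ φ / uPhi γ φ := fun φ hφ =>
    (div_pos (hPhi'_pos γ hφ) (uPhi_pos hγ hφ)).le
  constructor
  · intro h
    refine mul_le_mul_of_nonneg_left (setIntegral_mono_on hi hg measurableSet_Ioo fun φ hφ => ?_)
      (by positivity)
    rw [gTilde_eq hγ b hφ]
    exact mul_le_mul_of_nonneg_left (mul_le_mul_of_nonneg_right (h φ hφ) (hpos φ hφ))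
      (Real.exp_pos _).le
  · intro h
    refine mul_le_mul_of_nonneg_left (setIntegral_mono_on hg hi measurableSet_Ioo fun φ hφ => ?_)
      (by positivity)
    rw [gTilde_eq hγ b hφ]
    exact mul_le_mul_of_nonneg_left (mul_le_mul_of_nonneg_right (h φ hφ) (hpos φ hφ))
      (Real.exp_pos _).le

/-- Since `θ_FA < γ < θ_MD`, both unit steps are evaluated at `-1` and vanish. -/
lemma errorApprox_eq {n : ℕ} {Ω γ : ℝ} (hMD : γ < theta Ω γ .MD) (hFA : theta Ω γ .FA < γ)
    (K : ℕ) (b : ErrorType) : errorApprox n Ω γ K b = errSign b * (gTrunc n Ω γ b K *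
      Real.exp (n / (2 * Real.sinh γ) * alpha γ (theta Ω γ b))) := by
  have h : -(1 / 2) * (n : ℝ) * vExp Ω γ b =
      n / (2 * Real.sinh γ) * alpha γ (theta Ω γ b) := by
    rw [vExp]
    ring
  cases b
  · rw [errorApprox, h, sgn, Real.sign_of_neg (by linarith), unitStep, errSign]
    norm_num
  · rw [errorApprox, h, sgn, Real.sign_of_pos (by linarith), unitStep, errSign]
    norm_num

end AWGN

/-! ### The bounds on the error probabilities -/

theorem theorem7 (n : ℕ) (hn : 1 ≤ n) (vx vw : NNReal) (hvx : 0 < vx) (hvw : 0 < vw)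
    (γ : ℝ)
    (hγ_lower : 1 / 2 * Real.log (1 + AWGN.snr vx vw / (1 + AWGN.snr vx vw)) < γ)
    (hγ_upper : γ < 1 / 2 * Real.log (1 + AWGN.snr vx vw))
    (x : EuclideanSpace ℝ (Fin n)) (hx : x ∈ AWGN.codewords n vx)
    (L U : ℕ) (hL : 1 ≤ L) (hU : 1 ≤ U) (b : AWGN.ErrorType) :
    ((∀ φ ∈ Set.Ioo 0 Real.pi,
        AWGN.ratioTrunc (AWGN.snr vx vw) γ b L φ ≤
          AWGN.cPhi (AWGN.snr vx vw) γ b φ / AWGN.cEven (AWGN.snr vx vw) γ b 0) →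
      AWGN.errorApprox n (AWGN.snr vx vw) γ L b ≤
        AWGN.errorProb vx vw x (AWGN.threshold (AWGN.snr vx vw) γ) b) ∧
    ((∀ φ ∈ Set.Ioo 0 Real.pi,
        AWGN.cPhi (AWGN.snr vx vw) γ b φ / AWGN.cEven (AWGN.snr vx vw) γ b 0 ≤
          AWGN.ratioTrunc (AWGN.snr vx vw) γ b U φ) →
      AWGN.errorProb vx vw x (AWGN.threshold (AWGN.snr vx vw) γ) b ≤
        AWGN.errorApprox n (AWGN.snr vx vw) γ U b) := by
  have hΩ : 0 < AWGN.snr vx vw := div_pos (NNReal.coe_pos.2 hvx) (NNReal.coe_pos.2 hvw)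
  have hγ : 0 < γ := by
    have : 0 < Real.log (1 + AWGN.snr vx vw / (1 + AWGN.snr vx vw)) :=
      Real.log_pos (lt_add_of_pos_right _ (by positivity))
    linarith
  have hMD := AWGN.lt_theta_MD hΩ hγ hγ_upper
  have hFA := AWGN.theta_FA_lt hΩ hγ hγ_lower
  have hprob := AWGN.errorProb_eq hn hvx hvw hγ hx hMD hFA b
  rw [AWGN.errorApprox_eq hMD hFA, AWGN.errorApprox_eq hMD hFA, hprob]
  set Ω := AWGN.snr vx vw
  set e := Real.exp (n / (2 * Real.sinh γ) * AWGN.alpha γ (AWGN.theta Ω γ b))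
  have he : 0 < e := Real.exp_pos _
  have hq : 0 < Real.exp γ / √(Real.cosh γ) :=
    div_pos (Real.exp_pos _) (Real.sqrt_pos.2 (Real.cosh_pos _))
  set J := ∫ φ in Set.Ioo 0 Real.pi, Real.exp (-(n / (2 * Real.sinh γ)) * AWGN.hPhi γ φ) *
    AWGN.gTilde Ω γ b φ
  have hJ : e / Real.pi * J = 1 / Real.pi * J * e := by ring
  rw [hJ]
  have hc0 := AWGN.cEven_zero (Ω := Ω) hγ b
  cases b with
  | MD =>
    have hpos : 0 < AWGN.cEven Ω γ .MD 0 := by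
      rw [hc0]
      exact div_pos hq (sub_pos.2 (Real.exp_lt_exp.2 hMD))
    simp only [AWGN.errSign, one_mul]
    constructor
    · intro h
      refine mul_le_mul_of_nonneg_right ((AWGN.gTrunc_bounds hn hγ hMD.ne L).1 fun φ hφ => ?_) he.le
      rw [← AWGN.cEven_zero_mul_ratioTrunc hpos.ne' hL, mul_comm]
      exact (le_div_iff₀ hpos).1 (h φ hφ)
    · intro h
      refine mul_le_mul_of_nonneg_right ((AWGN.gTrunc_bounds hn hγ hMD.ne U).2 fun φ hφ => ?_) he.le
      rw [← AWGN.cEven_zero_mul_ratioTrunc hpos.ne' hU, mul_comm]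
      exact (div_le_iff₀ hpos).1 (h φ hφ)
  | FA =>
    -- Multiplying by the negative `c_0` reverses the hypothesis, so the lower bound on `P` uses the
    -- upper bound on the integral, and conversely.
    have hneg : AWGN.cEven Ω γ .FA 0 < 0 := by
      rw [hc0]
      exact div_neg_of_pos_of_neg hq (sub_neg.2 (Real.exp_lt_exp.2 hFA))
    simp only [AWGN.errSign, neg_one_mul, neg_le_neg_iff]
    constructor
    · intro h
      refine mul_le_mul_of_nonneg_right
        ((AWGN.gTrunc_bounds hn hγ hFA.ne' L).2 fun φ hφ => ?_) he.le
      rw [← AWGN.cEven_zero_mul_ratioTrunc hneg.ne hL, mul_comm]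
      exact (le_div_iff_of_neg hneg).1 (h φ hφ)
    · intro h
      refine mul_le_mul_of_nonneg_right
        ((AWGN.gTrunc_bounds hn hγ hFA.ne' U).1 fun φ hφ => ?_) he.le
      rw [← AWGN.cEven_zero_mul_ratioTrunc hneg.ne hU, mul_comm]
      exact (div_le_iff_of_neg hneg).1 (h φ hφ)
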